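/- Let $d\ge 1$ and write points of $\mathbb{R}^d$ as $x=(x_1,x')\in\mathbb{R}\times\mathbb{R}^{d-1}$. For $\sigma\in\mathbb{R}$ let $$\mathcal X^\sigma=L^{2,\sigma}(\mathbb{R};L^2(\mathbb{R}^{d-1}))=\Big\{r:\mathbb{R}^d\to\mathbb{C}\ \Big|\ \|r\|_{\mathcal X^\sigma}^2=\int_{\mathbb{R}^d}(1+x_1^2)^\sigma|r(x)|^2\,dx<\infty\Big\},$$ so that $\mathcal X^\sigma\subset L^2(\mathbb{R}^d)$ for $\sigma\ge 0$. Let $\psi:\mathbb{R}^{d-1}\to\mathbb{R}$ satisfy $\psi(x')>\ell>0$ for all $x'$ and $|\psi(x')-\psi(y')|\le L|x'-y'|$ for all $x',y'$, where $L\ge 0$. Let $H_1$ be the closure in $L^2(\mathbb{R}^d)$ of the operator $-i\psi(x')\,\partial/\partial x_1$ with domain $C_0^\infty(\mathbb{R}^d)$. For $\lambda\in\mathbb{R}$ put $L_{\Gamma_\lambda}=|\lambda|L/\ell^2$. The spectral family $\{E(\lambda)\}_{\lambda\in\mathbb{R}}$ of $H_1$ is the family of orthogonal projections such that, for each $\lambda$,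 the range of $E(\lambda)$ is the largest closed subspace of $L^2(\mathbb{R}^d)$ which reduces $H_1$ and on which $(H_1u,u)\le\lambda(u,u)$ for every $u$ in it that lies in $D(H_1)$. Let $\sigma>\frac12$. Then $\mathcal X^{-\sigma}$ is isometrically the space $(\mathcal X^{\sigma})^*$ of bounded antilinear functionals on $\mathcal X^\sigma$, through the pairing $\langle u,v\rangle=\int_{\mathbb{R}^d}u\,\overline{v}\,dx$ ($u\in\mathcal X^{-\sigma}$, $v\in\mathcal X^{\sigma}$). Moreover, for every $\ell>0$ there is a constant $C(\sigma,\ell)>0$, depending only on $\sigma$ and $\ell$, such that for all $d$, $\psi$, $L$ as above the following holds. The operator $H_1$ is self-adjoint, its spectral family exists and is unique, and for every $\lambda\in\mathbb{R}$ there is a bounded linear operator $A(\lambda):\mathcal X^\sigma\to\mathcal X^{-\sigma}$ such that, for all $f,g\in\mathcal X^\sigma$, the function $\mu\mapsto(E(\mu)f,g)_{L^2(\mathbb{R}^d)}$ is differentiable at $\mu=\lambda$ and $$\langle A(\lambda)f,g\rangle=\frac{d}{d\mu}\Big|_{\mu=\lambda}(E(\mu)f,g)_{L^2(\mathbb{R}^d)},$$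 and, with the same constant $C(\sigma,\ell)$, $$\Big|\frac{d}{d\mu}\Big|_{\mu=\lambda}(E(\mu)f,g)_{L^2(\mathbb{R}^d)}\Big|\le C(\sigma,\ell)(1+L_{\Gamma_\lambda})\|f\|_{\mathcal X^\sigma}\|g\|_{\mathcal X^\sigma},\qquad \|A(\lambda)\|_{\mathcal B(\mathcal X^\sigma,\mathcal X^{-\sigma})}\le C(\sigma,\ell)(1+L_{\Gamma_\lambda}).$$ -/

import Mathlib

open MeasureTheory
open scoped ENNReal NNReal ContDiff ComplexConjugate

noncomputable section

namespace ShearFlow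

/-! ### Spectral families of unbounded operators -/

section SpectralFamily

variable {𝓗 : Type*} [NormedAddCommGroup 𝓗] [InnerProductSpace ℂ 𝓗] [CompleteSpace 𝓗]

/-- The orthogonal projection `P` (equivalently, the closed subspace `P 𝓗`) reduces `H`, and
`(H u, u) ≤ μ (u, u)` for every `u` in `P 𝓗 ∩ D(H)`. -/
structure ReducesBelow (H : 𝓗 →ₗ.[ℂ] 𝓗) (μ : ℝ) (P : 𝓗 →L[ℂ] 𝓗) : Prop where
  isStarProjection : IsStarProjection P
  reduces : ∀ g : H.domain, ∃ h : P g ∈ H.domain, H ⟨P g, h⟩ = P (H g)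
  le : ∀ u : H.domain, P u = u → (inner ℂ (u : 𝓗) (H u)).re ≤ μ * ‖(u : 𝓗)‖ ^ 2

/-- `E` is the spectral family of `H`: for each real `μ`, `E μ` is the orthogonal projection onto
the largest closed subspace which reduces `H` and on which `(H u, u) ≤ μ (u, u)`. -/
def IsSpectralFamily (H : 𝓗 →ₗ.[ℂ] 𝓗) (E : ℝ → 𝓗 →L[ℂ] 𝓗) : Prop :=
  ∀ μ : ℝ, ReducesBelow H μ (E μ) ∧
    ∀ P : 𝓗 →L[ℂ] 𝓗, ReducesBelow H μ P →
      LinearMap.range (P : 𝓗 →ₗ[ℂ] 𝓗) ≤ LinearMap.range (E μ : 𝓗 →ₗ[ℂ] 𝓗)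

end SpectralFamily

/-! ### The spaces -/

/-- `ℝ^d = ℝ × ℝ^(d-1)` with `d = n + 1`; points are `x = (x₁, x')`. The measure `volume` on it is
Lebesgue measure. -/
abbrev Space (n : ℕ) : Type := ℝ × EuclideanSpace ℝ (Fin n)

/-- The Hilbert space `L²(ℝ^d)`, `d = n + 1`. -/
abbrev L2 (n : ℕ) : Type := Lp ℂ 2 (volume : Measure (Space n))

/-- The measure `(1 + x₁²)^σ dx` on `ℝ^d`. -/
def weightMeasure (n : ℕ) (σ : ℝ) : Measure (Space n) :=
  volume.withDensity fun x => ENNReal.ofReal ((1 + x.1 ^ 2) ^ σ)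

/-- `𝓧^σ = L^{2,σ}(ℝ; L²(ℝ^(d-1)))`, the space of (classes of) functions `r : ℝ^d → ℂ` with
`‖r‖² = ∫ (1 + x₁²)^σ |r(x)|² dx < ∞`, for any real `σ`. -/
abbrev X (n : ℕ) (σ : ℝ) : Type := Lp ℂ 2 (weightMeasure n σ)

theorem volume_le_weightMeasure (n : ℕ) {σ : ℝ} (hσ : 0 ≤ σ) :
    (volume : Measure (Space n)) ≤ weightMeasure n σ := by
  conv_lhs => rw [← withDensity_one (μ := (volume : Measure (Space n)))]
  refine withDensity_mono (Filter.Eventually.of_forall fun x => ?_)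
  simp only [Pi.one_apply]
  rw [← ENNReal.ofReal_one]
  exact ENNReal.ofReal_le_ofReal (Real.one_le_rpow (by nlinarith [sq_nonneg x.1]) hσ)

/-- The inclusion `𝓧^σ ⊆ L²(ℝ^d)` for `σ ≥ 0`. -/
def X.toL2 {n : ℕ} {σ : ℝ} (hσ : 0 ≤ σ) (f : X n σ) : L2 n :=
  ((Lp.memLp f).mono_measure (volume_le_weightMeasure n hσ)).toLp f

/-- The `(𝓧^(-σ), 𝓧^σ)` pairing induced by the inner product of `L²(ℝ^d)`:
`⟨u, v⟩ = ∫ u(x) conj(v(x)) dx`. -/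
def pairing {n : ℕ} {σ : ℝ} (u : X n (-σ)) (v : X n σ) : ℂ :=
  ∫ x : Space n, u x * conj (v x)

/-! ### The shear flow operator -/

/-- The graph of `-i ψ(x') ∂/∂x₁` with domain `C₀^∞(ℝ^d)`, as a subspace of `L² × L²`. -/
def testGraph {n : ℕ} (ψ : EuclideanSpace ℝ (Fin n) → ℝ) : Submodule ℂ (L2 n × L2 n) where
  carrier := {p | ∃ φ : Space n → ℂ, ContDiff ℝ ∞ φ ∧ HasCompactSupport φ ∧
    p.1 =ᵐ[volume] φ ∧
    p.2 =ᵐ[volume] fun x => -Complex.I * (ψ x.2 : ℂ) * deriv (fun t => φ (t, x.2)) x.1}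
  zero_mem' := by
    refine ⟨0, contDiff_const, HasCompactSupport.zero, Lp.coeFn_zero _ _ _, ?_⟩
    filter_upwards [Lp.coeFn_zero ℂ 2 (volume : Measure (Space n))] with x hx
    simp
  add_mem' := by
    rintro ⟨a, a'⟩ ⟨b, b'⟩ ⟨φ, h1, h2, h3, h4⟩ ⟨χ, k1, k2, k3, k4⟩
    refine ⟨φ + χ, h1.add k1, h2.add k2, ?_, ?_⟩
    · exact (Lp.coeFn_add a b).trans (h3.add k3)
    · filter_upwards [Lp.coeFn_add a' b', h4, k4] with x hx h k
      have e1 : DifferentiableAt ℝ (fun t => φ (t, x.2)) x.1 :=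
        ((h1.differentiable (by simp)).comp (by fun_prop)).differentiableAt
      have e2 : DifferentiableAt ℝ (fun t => χ (t, x.2)) x.1 :=
        ((k1.differentiable (by simp)).comp (by fun_prop)).differentiableAt
      simp only [Prod.mk_add_mk, hx, Pi.add_apply, h, k]
      rw [deriv_fun_add e1 e2]
      ring
  smul_mem' := by
    rintro c ⟨a, a'⟩ ⟨φ, h1, h2, h3, h4⟩
    refine ⟨c • φ, contDiff_const.smul h1, h2.smul_left (f := fun _ => c), ?_, ?_⟩
    · exact (Lp.coeFn_smul c a).trans (h3.const_smul c)
    · filter_upwards [Lp.coeFn_smul c a', h4] with x hx h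
      simp only [Prod.smul_mk, hx, Pi.smul_apply, h, smul_eq_mul]
      rw [deriv_const_mul_field]
      ring

/-- `testGraph ψ` is the graph of a function, so `Submodule.toLinearPMap` really turns it into the
operator with this graph. -/
theorem testGraph_functional {n : ℕ} (ψ : EuclideanSpace ℝ (Fin n) → ℝ) :
    ∀ p ∈ testGraph ψ, p.1 = 0 → p.2 = 0 := by
  rintro ⟨a, b⟩ ⟨φ, h1, -, h3, h4⟩ h0
  simp only at h0 h3 h4 ⊢
  subst h0
  have hφ : φ = 0 := by
    refine (Continuous.ae_eq_iff_eq volume h1.continuous continuous_const).1 ?_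
    exact h3.symm.trans (Lp.coeFn_zero _ _ _)
  subst hφ
  refine Lp.ext (h4.trans ?_)
  filter_upwards [Lp.coeFn_zero ℂ 2 (volume : Measure (Space n))] with x hx
  simp

/-- The operator `-i ψ(x') ∂/∂x₁ : C₀^∞(ℝ^d) ⊆ L²(ℝ^d) → L²(ℝ^d)`. -/
def shearTest {n : ℕ} (ψ : EuclideanSpace ℝ (Fin n) → ℝ) : L2 n →ₗ.[ℂ] L2 n :=
  (testGraph ψ).toLinearPMap

theorem shearTest_graph {n : ℕ} (ψ : EuclideanSpace ℝ (Fin n) → ℝ) :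
    (shearTest ψ).graph = testGraph ψ :=
  Submodule.toLinearPMap_graph_eq _ (fun p hp h => testGraph_functional ψ p hp h)

/-- The shear flow operator `H₁ = -i ψ(x') ∂/∂x₁` on `L²(ℝ^d)`, the closure of its restriction to
`C₀^∞(ℝ^d)`. -/
def shearFlow {n : ℕ} (ψ : EuclideanSpace ℝ (Fin n) → ℝ) : L2 n →ₗ.[ℂ] L2 n :=
  (shearTest ψ).closure

/-- `H₁` is a regular shear flow: `ψ > ℓ > 0` everywhere and `ψ` is Lipschitz with constant `L`. -/
structure IsRegular {n : ℕ} (ψ : EuclideanSpace ℝ (Fin n) → ℝ) (ℓ : ℝ) (L : ℝ≥0) : Prop where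
  pos : 0 < ℓ
  lower : ∀ x', ℓ < ψ x'
  lipschitz : LipschitzWith L ψ

/-- `L_{Γ_λ} = |λ| L / ℓ²`, the Lipschitz constant of the surface
`Γ_λ = {(λ / ψ(x'), x')}`. -/
def surfaceLipschitz (ℓ : ℝ) (L : ℝ≥0) (lam : ℝ) : ℝ := |lam| * L / ℓ ^ 2

end ShearFlow

end

noncomputable section

namespace ShearFlow

open scoped FourierTransform

/-! ### The Fourier transform on `L¹ ∩ L²` of the line -/

section Line

/-! The Fourier transform in `x₁` alone, taken fibre by fibre over `x'`, turns `-i ψ(x') ∂₁` into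
multiplication by the real symbol `m(k, x') = 2πkψ(x')`, because `ψ` is constant along each fibre.
The range of `-iψ∂₁ - i` on test functions is dense (`dense_range_shear`): on almost every fibre, an
orthogonal vector is a weak `L²` solution of `g = ψ(x') g'`, whose nonzero solutions grow
exponentially. So the closure is the maximal multiplication operator (`diagonalizes_shearFlow`),
which is self-adjoint.

Its spectral family is multiplication by the indicator of `{m ≤ μ}`. The substance is maximality. If
`P` reduces `H` and `H ≤ μ` on its range, the resolvent preserves that range and has norm at most
`1/(Re z - μ)` there for `Re z > μ`. Its iterates would violate this bound if a transformed vector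
of the range had mass in a disc `|m - z| ≤ q < Re z - μ`. Such discs cover `m > μ`
(`ae_eq_zero_above`).

Consequently `(E(μ)f, g)` is the integral over `y` of the integral of `f̂ conj(ĝ)` over `k ≤
μ/(2πψ(y))`. For `σ > 1/2`, Cauchy–Schwarz puts almost every fibre in `L¹`, so `f̂(·, y)` is
continuous and bounded by a multiple of the weighted norm of the fibre. Differentiation under the
integral (`exists_hasDerivAt_inner_spectralProj`) gives a derivative bounded by `c/(2πℓ) ‖f‖ ‖g‖`
with `c = ∫ (1 + t²)^(-σ) dt`, uniformly in `λ`; the factor `1 + L_Γ ≥ 1` only enlarges this bound.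
The derivative is sesquilinear in `(f, g)`, and the Riesz theorem with the weight shift makes it an
operator into `𝓧^(-σ)`. -/

theorem integral_fourier_mul_eq {f g : ℝ → ℂ} (hf : Integrable f) (hg : Integrable g) :
    ∫ ξ, 𝓕 f ξ * g ξ = ∫ x, f x * 𝓕 g x := by
  have := VectorFourier.integral_fourierIntegral_smul_eq_flip (μ := volume) (ν := volume)
    (L := innerₗ ℝ) (f := f) (g := g) Real.continuous_fourierChar continuous_inner hf hg
  simpa [Real.fourier_eq, VectorFourier.fourierIntegral, real_inner_comm] using! this

theorem integral_conj_fourier_mul_eq {f g : ℝ → ℂ} (hf : Integrable f) (hg : Integrable g) :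
    ∫ ξ, conj (𝓕 f ξ) * g ξ = ∫ x, conj (f x) * 𝓕 g (-x) := by
  have := VectorFourier.integral_sesq_fourierIntegral_eq_neg_flip (μ := volume) (ν := volume)
    (L := innerₗ ℝ) (f := f) (g := g) (innerSL ℂ) Real.continuous_fourierChar continuous_inner hf hg
  simpa [Real.fourier_eq, VectorFourier.fourierIntegral, real_inner_comm, mul_comm] using! this

theorem continuous_fourier {f : ℝ → ℂ} (hf : Integrable f) : Continuous (𝓕 f) :=
  VectorFourier.fourierIntegral_continuous Real.continuous_fourierChar
    (by exact continuous_inner) hf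

theorem norm_fourier_le (f : ℝ → ℂ) (k : ℝ) : ‖𝓕 f k‖ ≤ ∫ t, ‖f t‖ :=
  VectorFourier.norm_fourierIntegral_le_integral_norm _ _ _ _ _

/-- Both sides act in the same way on smooth compactly supported functions: the distributional
identity for the `L²` transform and the `L¹` duality formula each move the transform onto the test
function. -/
theorem fourier_toLp_ae_eq {f : ℝ → ℂ} (hf : Integrable f) (hf2 : MemLp f 2) :
    (𝓕 (hf2.toLp f) : Lp ℂ 2 (volume : Measure ℝ)) =ᵐ[volume] 𝓕 f := by
  have hloc : LocallyIntegrable (fun x => (𝓕 (hf2.toLp f) : Lp ℂ 2 (volume : Measure ℝ)) x - 𝓕 f x)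
      volume :=
    ((Lp.memLp _).locallyIntegrable (by norm_num)).sub
      (continuous_fourier hf).locallyIntegrable
  have key := ae_eq_zero_of_integral_contDiff_smul_eq_zero hloc ?_
  · filter_upwards [key] with x hx
    exact sub_eq_zero.1 hx
  intro g hg hgc
  have hgc' : HasCompactSupport (fun x => (g x : ℂ)) := hgc.comp_left (g := Complex.ofReal) rfl
  have hg' : ContDiff ℝ ∞ (fun x => (g x : ℂ)) := Complex.ofRealCLM.contDiff.comp hg
  have h1 := congrArg (fun T => T (hgc'.toSchwartzMap hg'))
    (Lp.fourier_toTemperedDistribution_eq (hf2.toLp f))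
  simp only [TemperedDistribution.fourier_apply, Lp.toTemperedDistribution_apply] at h1
  have hS : Integrable (fun x => (g x : ℂ)) := hg'.continuous.integrable_of_hasCompactSupport hgc'
  have e1 : ∫ x, 𝓕 (hgc'.toSchwartzMap hg') x • (hf2.toLp f) x = ∫ x, f x * 𝓕 (fun x => (g x : ℂ)) x := by
    refine integral_congr_ae ?_
    filter_upwards [hf2.coeFn_toLp] with x hx
    rw [hx, SchwartzMap.fourier_coe, smul_eq_mul, mul_comm]
    rfl
  rw [e1, ← integral_fourier_mul_eq hf hS] at h1
  have e2 : ∀ x, g x • ((𝓕 (hf2.toLp f) : Lp ℂ 2 (volume : Measure ℝ)) x - 𝓕 f x) =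
      (hgc'.toSchwartzMap hg') x • (𝓕 (hf2.toLp f) : Lp ℂ 2 (volume : Measure ℝ)) x
        - 𝓕 f x * (g x : ℂ) := by
    intro x
    simp only [HasCompactSupport.toSchwartzMap_toFun, smul_eq_mul, Complex.real_smul]
    ring
  simp_rw [e2]
  rw [integral_sub, ← h1, sub_self]
  · have : LocallyIntegrable (𝓕 (hf2.toLp f) : Lp ℂ 2 (volume : Measure ℝ)) volume :=
      (Lp.memLp _).locallyIntegrable (by norm_num)
    simpa using! this.integrable_smul_left_of_hasCompactSupport hg'.continuous hgc'
  · exact ((continuous_fourier hf).mul hg'.continuous).integrable_of_hasCompactSupport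
      hgc'.mul_left

theorem eLpNorm_fourier_eq {f : ℝ → ℂ} (hf : Integrable f) (hf2 : MemLp f 2) :
    eLpNorm (𝓕 f) 2 volume = eLpNorm f 2 volume := by
  rw [← eLpNorm_congr_ae (fourier_toLp_ae_eq hf hf2), ← eLpNorm_congr_ae hf2.coeFn_toLp]
  have := Lp.norm_fourier_eq (hf2.toLp f)
  rw [Lp.norm_def, Lp.norm_def] at this
  exact (ENNReal.toReal_eq_toReal_iff' (Lp.memLp _).2.ne (Lp.memLp _).2.ne).1 this

theorem eLpNorm_two_sq {α E : Type*} [MeasurableSpace α] [NormedAddCommGroup E] (μ : Measure α)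
    (f : α → E) : eLpNorm f 2 μ ^ 2 = ∫⁻ x, ‖f x‖ₑ ^ 2 ∂μ := by
  have h := eLpNorm_nnreal_pow_eq_lintegral (μ := μ) (f := f) (p := 2) two_ne_zero
  simp only [NNReal.coe_ofNat, ENNReal.rpow_two, ENNReal.coe_ofNat] at h
  exact h

theorem lintegral_enorm_fourier_sq {f : ℝ → ℂ} (hf : Integrable f) (hf2 : MemLp f 2) :
    ∫⁻ k, ‖𝓕 f k‖ₑ ^ 2 = ∫⁻ t, ‖f t‖ₑ ^ 2 := by
  rw [← eLpNorm_two_sq, ← eLpNorm_two_sq, eLpNorm_fourier_eq hf hf2]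

end Line
end ShearFlow
end

noncomputable section

namespace ShearFlow

open scoped FourierTransform

/-! ### Fibres over the transversal variable -/

section Fibre

variable {n : ℕ}

theorem ae_ae_fibre {p : Space n → Prop} (h : ∀ᵐ x, p x) :
    ∀ᵐ y : EuclideanSpace ℝ (Fin n), ∀ᵐ t : ℝ, p (t, y) := by
  have h' : ∀ᵐ z ∂((volume : Measure (EuclideanSpace ℝ (Fin n))).prod (volume : Measure ℝ)),
      p z.swap := Measure.measurePreserving_swap.quasiMeasurePreserving.ae h
  exact Measure.ae_ae_of_ae_prod h'

/-- A null set of `y` pulls back to a null set of `x`. Asking for every `t`, not almost every `t`,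
avoids any measurability condition on `p`. -/
theorem ae_of_ae_snd {p : Space n → Prop}
    (h : ∀ᵐ y : EuclideanSpace ℝ (Fin n), ∀ t : ℝ, p (t, y)) : ∀ᵐ x, p x := by
  have h' : ∀ᵐ x : Space n, ∀ t : ℝ, p (t, x.2) :=
    Measure.quasiMeasurePreserving_snd.ae h
  filter_upwards [h'] with x hx using hx x.1

theorem lintegral_fibre {f : Space n → ℝ≥0∞} (hf : AEMeasurable f) :
    ∫⁻ x, f x = ∫⁻ y : EuclideanSpace ℝ (Fin n), ∫⁻ t : ℝ, f (t, y) :=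
  lintegral_prod_symm f hf

theorem integral_fibre {f : Space n → ℂ} (hf : Integrable f) :
    ∫ x, f x = ∫ y : EuclideanSpace ℝ (Fin n), ∫ t : ℝ, f (t, y) :=
  integral_prod_symm f hf

theorem memLp_two_iff_lintegral {α E : Type*} [MeasurableSpace α] [NormedAddCommGroup E]
    {μ : Measure α} {f : α → E} :
    MemLp f 2 μ ↔ AEStronglyMeasurable f μ ∧ ∫⁻ x, ‖f x‖ₑ ^ 2 ∂μ < ⊤ := by
  rw [MemLp, ← eLpNorm_two_sq]
  simp

theorem memLp_fibre {f : Space n → ℂ} (hf : MemLp f 2) :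
    ∀ᵐ y : EuclideanSpace ℝ (Fin n), MemLp (fun t : ℝ => f (t, y)) 2 := by
  have h := memLp_two_iff_lintegral.1 hf
  have h1 : ∀ᵐ y : EuclideanSpace ℝ (Fin n), AEStronglyMeasurable (fun t : ℝ => f (t, y)) :=
    (h.1.prod_swap).prodMk_left
  have hm : AEMeasurable (fun x => ‖f x‖ₑ ^ 2) (volume : Measure (Space n)) :=
    h.1.enorm.pow_const 2
  have h2 := h.2
  rw [lintegral_fibre hm] at h2
  filter_upwards [h1, ae_lt_top' (AEMeasurable.lintegral_prod_left' hm) h2.ne] with y h1 h2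
  exact memLp_two_iff_lintegral.2 ⟨h1, h2⟩

theorem fibre_congr {f g : Space n → ℂ} (h : f =ᵐ[volume] g) :
    ∀ᵐ y : EuclideanSpace ℝ (Fin n), (fun t : ℝ => f (t, y)) =ᵐ[volume] fun t => g (t, y) :=
  ae_ae_fibre h

/-- The Fourier transform in the first variable, given by the Fourier integral on each fibre. -/
def fibreFourier (f : Space n → ℂ) : Space n → ℂ := fun x => 𝓕 (fun t : ℝ => f (t, x.2)) x.1

/-- A Fourier integral ignores null sets of its fibre, so equality holds at every frequency. Values
at single frequencies matter: the derivative of the spectral family samples the transform on a graph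
over `y`. -/
theorem fibreFourier_congr {f g : Space n → ℂ} (h : f =ᵐ[volume] g) :
    ∀ᵐ y : EuclideanSpace ℝ (Fin n), ∀ k : ℝ, fibreFourier f (k, y) = fibreFourier g (k, y) := by
  filter_upwards [fibre_congr h] with y hy k
  simp only [fibreFourier, Real.fourier_eq]
  refine integral_congr_ae ?_
  filter_upwards [hy] with t ht
  simp only [ht]

/-- Measurability up to a null set would not suffice later, when the transform is restricted to the
null set `k = λ / (2πψ(y))`. -/
theorem stronglyMeasurable_fibreFourier {f : Space n → ℂ} (hf : StronglyMeasurable f) :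
    StronglyMeasurable (fibreFourier f) := by
  unfold fibreFourier
  simp only [Real.fourier_eq]
  refine StronglyMeasurable.integral_prod_right' (f := fun p : Space n × ℝ =>
    Real.fourierChar (-(inner ℝ p.2 p.1.1)) • f (p.2, p.1.2)) ?_
  refine StronglyMeasurable.smul (𝕜 := Circle) (β := ℂ) ?_ (hf.comp_measurable (by fun_prop))
  exact (Real.continuous_fourierChar.comp (by fun_prop)).stronglyMeasurable

variable (n) in
/-- The classes of square integrable functions whose fibres are integrable. -/
def fibreIntegrable : Submodule ℂ (L2 n) where
  carrier := {f | ∀ᵐ y : EuclideanSpace ℝ (Fin n), Integrable fun t : ℝ => f (t, y)}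
  zero_mem' := by
    filter_upwards [fibre_congr (Lp.coeFn_zero ℂ 2 (volume : Measure (Space n)))] with y hy
    exact (integrable_zero ℝ ℂ volume).congr hy.symm
  add_mem' := by
    intro f g hf hg
    simp only [Set.mem_ofPred_eq] at hf hg ⊢
    filter_upwards [fibre_congr (Lp.coeFn_add f g), hf, hg] with y hy h1 h2
    exact (h1.add h2).congr hy.symm
  smul_mem' := by
    intro c f hf
    simp only [Set.mem_ofPred_eq] at hf ⊢
    filter_upwards [fibre_congr (Lp.coeFn_smul c f), hf] with y hy h1
    exact (h1.smul c).congr hy.symm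

theorem mem_fibreIntegrable {f : L2 n} : f ∈ fibreIntegrable n ↔
    ∀ᵐ y : EuclideanSpace ℝ (Fin n), Integrable fun t : ℝ => f (t, y) := Iff.rfl

theorem mem_fibreIntegrable_of_ae_eq {f : L2 n} {g : Space n → ℂ} (h : f =ᵐ[volume] g)
    (hg : ∀ᵐ y : EuclideanSpace ℝ (Fin n), Integrable fun t : ℝ => g (t, y)) :
    f ∈ fibreIntegrable n := by
  rw [mem_fibreIntegrable]
  filter_upwards [fibre_congr h, hg] with y hy h1
  exact h1.congr hy.symm

theorem mem_fibreIntegrable_of_integrable {f : L2 n} (h : Integrable f) :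
    f ∈ fibreIntegrable n :=
  h.prod_left_ae

/-- Square integrable simple functions are integrable, and by Fubini so are almost all of their
fibres. -/
theorem dense_fibreIntegrable : Dense (fibreIntegrable n : Set (L2 n)) := by
  refine (Lp.simpleFunc.denseRange (E := ℂ) (μ := (volume : Measure (Space n)))
    (p := 2) (by simp)).mono ?_
  rintro _ ⟨f, rfl⟩
  refine mem_fibreIntegrable_of_integrable ?_
  have h := (SimpleFunc.memLp_iff_integrable (by simp) (by simp)).1 (Lp.simpleFunc.memLp f)
  exact h.congr (Lp.simpleFunc.toSimpleFunc_eq_toFun f)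

theorem lintegral_enorm_fibreFourier_sq_of_measurable {f : Space n → ℂ} (hm : StronglyMeasurable f)
    (hf : ∀ᵐ y : EuclideanSpace ℝ (Fin n), Integrable fun t : ℝ => f (t, y))
    (hf2 : MemLp f 2 volume) :
    ∫⁻ x, ‖fibreFourier f x‖ₑ ^ 2 = ∫⁻ x, ‖f x‖ₑ ^ 2 := by
  have m1 : AEMeasurable (fun x => ‖fibreFourier f x‖ₑ ^ 2) (volume : Measure (Space n)) :=
    ((stronglyMeasurable_fibreFourier hm).enorm.pow_const 2).aemeasurable
  have m2 : AEMeasurable (fun x => ‖f x‖ₑ ^ 2) (volume : Measure (Space n)) :=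
    (hm.enorm.pow_const 2).aemeasurable
  rw [lintegral_fibre m1, lintegral_fibre m2]
  refine lintegral_congr_ae ?_
  have hf2' := memLp_fibre hf2
  filter_upwards [hf, hf2'] with y h1 h2
  have := lintegral_enorm_fourier_sq h1 h2
  unfold fibreFourier
  exact this

theorem lintegral_enorm_fibreFourier_sq {f : L2 n} (hf : f ∈ fibreIntegrable n) :
    ∫⁻ x, ‖fibreFourier f x‖ₑ ^ 2 = ∫⁻ x, ‖f x‖ₑ ^ 2 :=
  lintegral_enorm_fibreFourier_sq_of_measurable (Lp.stronglyMeasurable f) hf (Lp.memLp f)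

theorem memLp_fibreFourier {f : L2 n} (hf : f ∈ fibreIntegrable n) :
    MemLp (fibreFourier f) 2 volume := by
  refine memLp_two_iff_lintegral.2
    ⟨(stronglyMeasurable_fibreFourier (Lp.stronglyMeasurable f)).aestronglyMeasurable, ?_⟩
  rw [lintegral_enorm_fibreFourier_sq hf]
  exact (memLp_two_iff_lintegral.1 (Lp.memLp f)).2

variable (n) in
/-- The Fourier transform in the first variable on functions with integrable fibres. -/
def partialFourierAux : fibreIntegrable n →ₗ[ℂ] L2 n where
  toFun f := (memLp_fibreFourier f.2).toLp _
  map_add' := by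
    rintro ⟨f, hf⟩ ⟨g, hg⟩
    rw [← MemLp.toLp_add]
    refine MemLp.toLp_congr _ _ (ae_of_ae_snd ?_)
    filter_upwards [fibreFourier_congr (Lp.coeFn_add f g), mem_fibreIntegrable.1 hf,
      mem_fibreIntegrable.1 hg] with y hy h1 h2 k
    refine (hy k).trans ?_
    exact congrFun (VectorFourier.fourierIntegral_add Real.continuous_fourierChar
      (by exact continuous_inner) h1 h2) k
  map_smul' := by
    rintro c ⟨f, hf⟩
    rw [RingHom.id_apply, ← MemLp.toLp_const_smul]
    refine MemLp.toLp_congr _ _ (ae_of_ae_snd ?_)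
    filter_upwards [fibreFourier_congr (Lp.coeFn_smul c f)] with y hy k
    refine (hy k).trans ?_
    simp only [fibreFourier, Pi.smul_apply, Real.fourier_eq, ← integral_smul]
    congr 1
    ext t
    rw [smul_comm]

theorem norm_partialFourierAux (f : fibreIntegrable n) : ‖partialFourierAux n f‖ = ‖f‖ := by
  rw [Submodule.coe_norm, Lp.norm_def, Lp.norm_def]
  congr 1
  have h : eLpNorm (partialFourierAux n f) 2 volume = eLpNorm (fibreFourier (f : L2 n)) 2 volume :=
    eLpNorm_congr_ae (MemLp.coeFn_toLp (memLp_fibreFourier f.2))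
  rw [h]
  refine (ENNReal.pow_right_strictMono two_ne_zero).injective ?_
  rw [eLpNorm_two_sq, eLpNorm_two_sq, lintegral_enorm_fibreFourier_sq f.2]

theorem denseRange_fibreIntegrable_subtype : DenseRange (fibreIntegrable n).subtype := by
  rw [DenseRange, Submodule.coe_subtype, Subtype.range_coe]
  exact dense_fibreIntegrable

variable (n) in
/-- The Fourier transform in the first variable, as a bounded operator on `L²(ℝ^d)`. -/
def partialFourier : L2 n →L[ℂ] L2 n :=
  (partialFourierAux n).extendOfNorm (fibreIntegrable n).subtype

theorem partialFourier_coe (f : fibreIntegrable n) :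
    partialFourier n f = partialFourierAux n f :=
  LinearMap.extendOfNorm_eq denseRange_fibreIntegrable_subtype
    ⟨1, fun f => by rw [norm_partialFourierAux, one_mul]; rfl⟩ f

theorem partialFourier_ae_eq {f : L2 n} (hf : f ∈ fibreIntegrable n) :
    partialFourier n f =ᵐ[volume] fibreFourier f := by
  rw [partialFourier_coe ⟨f, hf⟩]
  exact MemLp.coeFn_toLp (memLp_fibreFourier hf)

theorem norm_partialFourier (f : L2 n) : ‖partialFourier n f‖ = ‖f‖ := by
  refine dense_fibreIntegrable.induction (P := fun f => ‖partialFourier n f‖ = ‖f‖) ?_ ?_ f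
  · intro f hf
    rw [partialFourier_coe ⟨f, hf⟩, norm_partialFourierAux]
    rfl
  · exact isClosed_eq (by fun_prop) (by fun_prop)

/-! ### Adjoint and surjectivity of the partial Fourier transform -/

theorem measurePreserving_neg_fst :
    MeasurePreserving (fun x : Space n => ((-x.1, x.2) : Space n)) volume volume :=
  (Measure.measurePreserving_neg (volume : Measure ℝ)).prod
    (MeasurePreserving.id (volume : Measure (EuclideanSpace ℝ (Fin n))))

variable (n) in
/-- The reflection `x₁ ↦ -x₁` on `L²(ℝ^d)`. -/
def reflection : L2 n →ₗᵢ[ℂ] L2 n :=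
  Lp.compMeasurePreservingₗᵢ ℂ _ measurePreserving_neg_fst

theorem reflection_ae_eq (f : L2 n) :
    reflection n f =ᵐ[volume] fun x => f (-x.1, x.2) :=
  Lp.coeFn_compMeasurePreserving f measurePreserving_neg_fst

theorem L2_inner_eq (f g : L2 n) : inner ℂ f g = ∫ x, conj (f x) * g x := by
  simp only [L2.inner_def, RCLike.inner_apply, mul_comm]

theorem integrable_conj_mul (f g : L2 n) : Integrable fun x => conj (f x) * g x := by
  simpa only [RCLike.inner_apply, mul_comm] using L2.integrable_inner (𝕜 := ℂ) f g

/-- The adjoint of the one-dimensional transform is the transform followed by reflection; Fubini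
assembles the fibres. -/
theorem inner_partialFourier_aux {f g : L2 n} (hf : f ∈ fibreIntegrable n)
    (hg : g ∈ fibreIntegrable n) :
    inner ℂ (partialFourier n f) g = inner ℂ f (reflection n (partialFourier n g)) := by
  have hR : reflection n (partialFourier n g) =ᵐ[volume] fun x => fibreFourier g (-x.1, x.2) :=
    (reflection_ae_eq _).trans
      (measurePreserving_neg_fst.quasiMeasurePreserving.ae (partialFourier_ae_eq hg))
  rw [L2_inner_eq, L2_inner_eq, integral_fibre (integrable_conj_mul _ _),
    integral_fibre (integrable_conj_mul _ _)]
  refine integral_congr_ae ?_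
  filter_upwards [fibre_congr (partialFourier_ae_eq hf), fibre_congr hR,
    mem_fibreIntegrable.1 hf, mem_fibreIntegrable.1 hg]
    with y h1 h2 h3 h4
  have e1 : ∫ t : ℝ, conj ((partialFourier n f) (t, y)) * g (t, y)
      = ∫ t : ℝ, conj (𝓕 (fun t : ℝ => f (t, y)) t) * g (t, y) := by
    refine integral_congr_ae ?_
    filter_upwards [h1] with t ht
    rw [ht]
    rfl
  have e2 : ∫ t : ℝ, conj (f (t, y)) * (reflection n (partialFourier n g)) (t, y)
      = ∫ t : ℝ, conj (f (t, y)) * 𝓕 (fun t : ℝ => g (t, y)) (-t) := by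
    refine integral_congr_ae ?_
    filter_upwards [h2] with t ht
    rw [ht]
    rfl
  rw [e1, e2, integral_conj_fourier_mul_eq h3 h4]

theorem inner_partialFourier (f g : L2 n) :
    inner ℂ (partialFourier n f) g = inner ℂ f (reflection n (partialFourier n g)) := by
  refine dense_fibreIntegrable.induction
    (P := fun f => inner ℂ (partialFourier n f) g = inner ℂ f (reflection n (partialFourier n g)))
    ?_ ?_ f
  · intro f hf
    refine dense_fibreIntegrable.induction
      (P := fun g => inner ℂ (partialFourier n f) g
        = inner ℂ f (reflection n (partialFourier n g))) ?_ ?_ g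
    · exact fun g hg => inner_partialFourier_aux hf hg
    · exact isClosed_eq (by fun_prop)
        (continuous_const.inner ((reflection n).continuous.comp (partialFourier n).continuous))
  · exact isClosed_eq (by fun_prop) (by fun_prop)

/-- With `F` the transform and `R` the reflection, `(F R F f, g) = (R F f, R F g) = (f, g)`, since
`R F` is isometric. Surjectivity of `F` thus follows without an inversion formula. -/
theorem partialFourier_reflection_partialFourier (f : L2 n) :
    partialFourier n (reflection n (partialFourier n f)) = f := by
  let U : L2 n →ₗᵢ[ℂ] L2 n := ⟨(partialFourier n : L2 n →ₗ[ℂ] L2 n), norm_partialFourier⟩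
  refine ext_inner_right ℂ fun g => ?_
  rw [inner_partialFourier]
  have := ((reflection n).comp U).inner_map_map f g
  exact this

variable (n) in
/-- The Fourier transform in the first variable, as a unitary operator on `L²(ℝ^d)`. -/
def fourierUnitary : L2 n ≃ₗᵢ[ℂ] L2 n :=
  LinearIsometryEquiv.ofSurjective
    (⟨(partialFourier n : L2 n →ₗ[ℂ] L2 n), norm_partialFourier⟩ : L2 n →ₗᵢ[ℂ] L2 n)
    fun f => ⟨_, partialFourier_reflection_partialFourier f⟩

theorem fourierUnitary_ae_eq {f : L2 n} (hf : f ∈ fibreIntegrable n) :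
    fourierUnitary n f =ᵐ[volume] fibreFourier f :=
  partialFourier_ae_eq hf

end Fibre
end ShearFlow
end

noncomputable section

namespace ShearFlow

/-! ### Multiplication operators -/

section Multiplication

theorem sub_ne_zero_of_im (t : ℝ) {z : ℂ} (hz : z.im ≠ 0) : (t : ℂ) - z ≠ 0 := by
  intro h
  apply hz
  have := congrArg Complex.im h
  simpa using this

variable {α : Type*} {m : α → ℝ}

/-- The resolvent symbol `(m - z)⁻¹`. -/
def resolventSymbol (m : α → ℝ) (z : ℂ) (x : α) : ℂ := ((m x : ℂ) - z)⁻¹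

theorem norm_resolventSymbol_le {z : ℂ} (hz : z.im ≠ 0) (x : α) :
    ‖resolventSymbol m z x‖ ≤ |z.im|⁻¹ := by
  rw [resolventSymbol, norm_inv]
  refine inv_anti₀ (abs_pos.2 hz) ?_
  have := Complex.abs_im_le_norm ((m x : ℂ) - z)
  simpa using this

/-- The indicator function of `{m ≤ μ}`. -/
def belowSymbol (m : α → ℝ) (μ : ℝ) : α → ℂ := {x | m x ≤ μ}.indicator 1

theorem norm_belowSymbol_le (μ : ℝ) (x : α) : ‖belowSymbol m μ x‖ ≤ 1 := by
  unfold belowSymbol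
  by_cases h : m x ≤ μ <;> simp [h]

theorem conj_belowSymbol (μ : ℝ) (x : α) : conj (belowSymbol m μ x) = belowSymbol m μ x := by
  unfold belowSymbol
  by_cases h : m x ≤ μ <;> simp [h]

variable [MeasurableSpace α] {ν : Measure α}

/-- Multiplication by a bounded measurable function, as a bounded operator on `L²`. -/
def mulOp (b : α → ℂ) (hb : Measurable b) (C : ℝ) (hC : ∀ x, ‖b x‖ ≤ C) :
    Lp ℂ 2 ν →L[ℂ] Lp ℂ 2 ν :=
  LinearMap.mkContinuous
    { toFun := fun f => ((Lp.memLp f).of_le_mul (f := fun x => b x * f x) (c := C)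
        (hb.aestronglyMeasurable.mul (Lp.aestronglyMeasurable f))
        (Filter.Eventually.of_forall fun x => by
          rw [norm_mul]; exact mul_le_mul_of_nonneg_right (hC x) (norm_nonneg _))).toLp _
      map_add' := fun f g => by
        rw [← MemLp.toLp_add]
        refine MemLp.toLp_congr _ _ ?_
        filter_upwards [Lp.coeFn_add f g] with x hx
        simp only [hx, Pi.add_apply, mul_add]
      map_smul' := fun c f => by
        rw [RingHom.id_apply, ← MemLp.toLp_const_smul]
        refine MemLp.toLp_congr _ _ ?_
        filter_upwards [Lp.coeFn_smul c f] with x hx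
        simp only [hx, Pi.smul_apply, smul_eq_mul]
        ring }
    C fun f => by
      refine Lp.norm_le_mul_norm_of_ae_le_mul ?_
      simp only [LinearMap.coe_mk, AddHom.coe_mk]
      have h := MemLp.coeFn_toLp ((Lp.memLp f).of_le_mul (f := fun x => b x * f x) (c := C)
        (hb.aestronglyMeasurable.mul (Lp.aestronglyMeasurable f))
        (Filter.Eventually.of_forall fun x => by
          rw [norm_mul]; exact mul_le_mul_of_nonneg_right (hC x) (norm_nonneg _)))
      filter_upwards [h] with x hx
      rw [hx, norm_mul]
      exact mul_le_mul_of_nonneg_right (hC x) (norm_nonneg _)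

theorem mulOp_ae_eq (b : α → ℂ) (hb : Measurable b) (C : ℝ) (hC : ∀ x, ‖b x‖ ≤ C)
    (f : Lp ℂ 2 ν) : mulOp b hb C hC f =ᵐ[ν] fun x => b x * f x :=
  MemLp.coeFn_toLp ((Lp.memLp f).of_le_mul (f := fun x => b x * f x) (c := C)
    (hb.aestronglyMeasurable.mul (Lp.aestronglyMeasurable f))
    (Filter.Eventually.of_forall fun x => by
      rw [norm_mul]; exact mul_le_mul_of_nonneg_right (hC x) (norm_nonneg _)))

theorem Lp_inner_eq (f g : Lp ℂ 2 ν) : inner ℂ f g = ∫ x, conj (f x) * g x ∂ν := by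
  simp only [L2.inner_def, RCLike.inner_apply, mul_comm]

theorem inner_mulOp (b : α → ℂ) (hb : Measurable b) (C : ℝ) (hC : ∀ x, ‖b x‖ ≤ C)
    (hb' : ∀ x, conj (b x) = b x) (f g : Lp ℂ 2 ν) :
    inner ℂ (mulOp b hb C hC f) g = inner ℂ f (mulOp b hb C hC g) := by
  rw [Lp_inner_eq, Lp_inner_eq]
  refine integral_congr_ae ?_
  filter_upwards [mulOp_ae_eq b hb C hC f, mulOp_ae_eq b hb C hC g] with x h1 h2
  rw [h1, h2, map_mul, hb']
  ring

theorem measurable_resolventSymbol (hm : Measurable m) (z : ℂ) :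
    Measurable (resolventSymbol m z) :=
  ((Complex.measurable_ofReal.comp hm).sub_const z).inv

variable (ν) in
/-- Multiplication by `(m - z)⁻¹`. -/
def mulResolvent (hm : Measurable m) {z : ℂ} (hz : z.im ≠ 0) : Lp ℂ 2 ν →L[ℂ] Lp ℂ 2 ν :=
  mulOp (resolventSymbol m z) (measurable_resolventSymbol hm z) _ (norm_resolventSymbol_le hz)

theorem mulResolvent_ae_eq (hm : Measurable m) {z : ℂ} (hz : z.im ≠ 0) (f : Lp ℂ 2 ν) :
    mulResolvent ν hm hz f =ᵐ[ν] fun x => ((m x : ℂ) - z)⁻¹ * f x :=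
  mulOp_ae_eq _ _ _ _ f

theorem measurable_belowSymbol (hm : Measurable m) (μ : ℝ) : Measurable (belowSymbol m μ) :=
  measurable_one.indicator (measurableSet_le hm measurable_const)

variable (ν) in
/-- Multiplication by the indicator function of `{m ≤ μ}`. -/
def mulBelow (hm : Measurable m) (μ : ℝ) : Lp ℂ 2 ν →L[ℂ] Lp ℂ 2 ν :=
  mulOp (belowSymbol m μ) (measurable_belowSymbol hm μ) 1 (norm_belowSymbol_le μ)

theorem mulBelow_ae_eq (hm : Measurable m) (μ : ℝ) (f : Lp ℂ 2 ν) :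
    mulBelow ν hm μ f =ᵐ[ν] fun x => belowSymbol m μ x * f x :=
  mulOp_ae_eq _ _ _ _ f

end Multiplication

/-! ### Operators which are unitarily equivalent to a multiplication operator -/

section Diagonal

variable {α : Type*} [MeasurableSpace α] {ν : Measure α}
variable {𝓗 : Type*} [NormedAddCommGroup 𝓗] [InnerProductSpace ℂ 𝓗]

/-- `U` turns `H` into the maximal operator of multiplication by `m`. -/
def Diagonalizes (U : 𝓗 ≃ₗᵢ[ℂ] Lp ℂ 2 ν) (m : α → ℝ) (H : 𝓗 →ₗ.[ℂ] 𝓗) : Prop :=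
  ∀ u v : 𝓗, (u, v) ∈ H.graph ↔ U v =ᵐ[ν] fun x => (m x : ℂ) * U u x

variable {U : 𝓗 ≃ₗᵢ[ℂ] Lp ℂ 2 ν} {m : α → ℝ} {H : 𝓗 →ₗ.[ℂ] 𝓗}

variable (U) in
/-- The spectral projection belonging to the multiplication by `m`. -/
def spectralProj (hm : Measurable m) (μ : ℝ) : 𝓗 →L[ℂ] 𝓗 :=
  (U.symm : Lp ℂ 2 ν →L[ℂ] 𝓗) ∘L mulBelow ν hm μ ∘L (U : 𝓗 →L[ℂ] Lp ℂ 2 ν)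

theorem apply_spectralProj (hm : Measurable m) (μ : ℝ) (u : 𝓗) :
    U (spectralProj U hm μ u) = mulBelow ν hm μ (U u) :=
  U.apply_symm_apply _

theorem spectralProj_ae_eq (hm : Measurable m) (μ : ℝ) (u : 𝓗) :
    U (spectralProj U hm μ u) =ᵐ[ν] fun x => belowSymbol m μ x * U u x := by
  rw [apply_spectralProj]
  exact mulBelow_ae_eq hm μ _

theorem graph_mem_domain {u v : 𝓗} (h : (u, v) ∈ H.graph) :
    ∃ hu : u ∈ H.domain, H ⟨u, hu⟩ = v := by
  obtain ⟨y, h1, h2⟩ := (LinearPMap.mem_graph_iff H).1 h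
  simp only at h1 h2
  subst h1
  exact ⟨y.2, h2⟩

theorem eq_zero_of_mem_graph_smul (hH : Diagonalizes U m H) {z : ℂ} (hz : z.im ≠ 0) {w : 𝓗}
    (h : (w, z • w) ∈ H.graph) : w = 0 := by
  have h1 := (hH _ _).1 h
  rw [map_smul] at h1
  have : U w = 0 := by
    refine Lp.ext ?_
    filter_upwards [h1, Lp.coeFn_smul z (U w), Lp.coeFn_zero ℂ 2 ν] with x k1 k2 k3
    rw [k3]
    rw [k2, Pi.smul_apply, smul_eq_mul] at k1
    have : ((m x : ℂ) - z) * U w x = 0 := by rw [sub_mul, ← k1, sub_self]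
    simpa [sub_ne_zero_of_im (m x) hz] using this
  simpa using this

variable (U) in
/-- The resolvent belonging to the multiplication by `m`. -/
def resolventOp (hm : Measurable m) {z : ℂ} (hz : z.im ≠ 0) : 𝓗 →L[ℂ] 𝓗 :=
  (U.symm : Lp ℂ 2 ν →L[ℂ] 𝓗) ∘L mulResolvent ν hm hz ∘L (U : 𝓗 →L[ℂ] Lp ℂ 2 ν)

theorem resolventOp_ae_eq (hm : Measurable m) {z : ℂ} (hz : z.im ≠ 0) (u : 𝓗) :
    U (resolventOp U hm hz u) =ᵐ[ν] fun x => ((m x : ℂ) - z)⁻¹ * U u x := by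
  have : U (resolventOp U hm hz u) = mulResolvent ν hm hz (U u) := U.apply_symm_apply _
  rw [this]
  exact mulResolvent_ae_eq hm hz _

theorem resolventOp_mem_graph (hm : Measurable m) (hH : Diagonalizes U m H) {z : ℂ}
    (hz : z.im ≠ 0) (u : 𝓗) :
    (resolventOp U hm hz u, u + z • resolventOp U hm hz u) ∈ H.graph := by
  refine (hH _ _).2 ?_
  rw [map_add, map_smul]
  filter_upwards [Lp.coeFn_add (U u) (z • U (resolventOp U hm hz u)),
    Lp.coeFn_smul z (U (resolventOp U hm hz u)), resolventOp_ae_eq hm hz u (U := U)] with x h1 h2 h3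
  rw [h1, Pi.add_apply, h2, Pi.smul_apply, h3, smul_eq_mul]
  field_simp [sub_ne_zero_of_im (m x) hz]
  ring

variable [CompleteSpace 𝓗]

theorem isStarProjection_spectralProj (hm : Measurable m) (μ : ℝ) :
    IsStarProjection (spectralProj U hm μ) := by
  refine ⟨?_, ?_⟩
  · ext u
    apply U.injective
    refine Lp.ext ?_
    filter_upwards [spectralProj_ae_eq hm μ u (U := U),
      spectralProj_ae_eq hm μ (spectralProj U hm μ u) (U := U)] with x h1 h2
    rw [mul_apply_eq_comp, h2, h1]
    unfold belowSymbol
    by_cases h : m x ≤ μ <;> simp [h]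
  · rw [ContinuousLinearMap.isSelfAdjoint_iff_isSymmetric]
    intro u v
    simp only [ContinuousLinearMap.coe_coe]
    rw [← U.inner_map_map, ← U.inner_map_map, apply_spectralProj, apply_spectralProj]
    exact inner_mulOp _ _ _ _ (conj_belowSymbol μ) _ _

theorem reducesBelow_spectralProj (hm : Measurable m) (hH : Diagonalizes U m H) (μ : ℝ) :
    ReducesBelow H μ (spectralProj U hm μ) := by
  refine ⟨isStarProjection_spectralProj hm μ, fun g => ?_, fun u hu => ?_⟩
  · refine graph_mem_domain ((hH _ _).2 ?_)
    filter_upwards [(hH _ _).1 (H.mem_graph g), spectralProj_ae_eq hm μ (g : 𝓗) (U := U),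
      spectralProj_ae_eq hm μ (H g) (U := U)] with x h1 h2 h3
    rw [h3, h2, h1]
    ring
  · have h1 := (hH _ _).1 (H.mem_graph u)
    have h2 := spectralProj_ae_eq hm μ (u : 𝓗) (U := U)
    rw [hu] at h2
    -- Both sides become integrals, to be compared pointwise: the transform of `u` lives where `m ≤
    -- μ`.
    have e : μ * ‖(u : 𝓗)‖ ^ 2 = (inner ℂ (U u) ((μ : ℂ) • U u)).re := by
      rw [inner_smul_right, inner_self_eq_norm_sq_to_K, U.norm_map]
      rw [Complex.re_ofReal_mul, ← RCLike.ofReal_pow]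
      rfl
    rw [e, ← U.inner_map_map, L2.inner_def, L2.inner_def]
    have i1 := L2.integrable_inner (𝕜 := ℂ) (U (u : 𝓗)) (U (H u))
    have i2 := L2.integrable_inner (𝕜 := ℂ) (U (u : 𝓗)) ((μ : ℂ) • U (u : 𝓗))
    have r1 := integral_re i1
    have r2 := integral_re i2
    simp only [RCLike.re_eq_complex_re] at r1 r2
    rw [← r1, ← r2]
    refine integral_mono_ae i1.re i2.re ?_
    filter_upwards [h1, h2, Lp.coeFn_smul (μ : ℂ) (U (u : 𝓗))] with x k1 k2 k3
    simp only [k1, k3, Pi.smul_apply, smul_eq_mul, RCLike.inner_apply]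
    rw [mul_assoc, mul_assoc, Complex.mul_conj, ← Complex.ofReal_mul, ← Complex.ofReal_mul,
      Complex.ofReal_re, Complex.ofReal_re]
    by_cases h : m x ≤ μ
    · exact mul_le_mul_of_nonneg_right h (Complex.normSq_nonneg _)
    · have : U (u : 𝓗) x = 0 := by
        rw [k2]
        simp [belowSymbol, h]
      simp [this]

/-! ### Maximality of the spectral projection -/

/-- With `w` the resolvent of `u`, applying `P` to the graph point `(w, u + z w)` gives `(P w, u + z
P w)`. The difference has the form `(d, z d)`, and a symbol with real values has no nonreal
eigenvalue. -/
theorem resolventOp_fixed (hm : Measurable m) (hH : Diagonalizes U m H) {μ : ℝ} {P : 𝓗 →L[ℂ] 𝓗}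
    (hP : ReducesBelow H μ P) {z : ℂ} (hz : z.im ≠ 0) {u : 𝓗} (hu : P u = u) :
    P (resolventOp U hm hz u) = resolventOp U hm hz u := by
  set w := resolventOp U hm hz u with hw
  have h := resolventOp_mem_graph hm hH hz u
  rw [← hw] at h
  obtain ⟨hd, hv⟩ := graph_mem_domain h
  obtain ⟨hd', hv'⟩ := hP.reduces ⟨w, hd⟩
  have h2 : (P w, P (u + z • w)) ∈ H.graph := by
    rw [← hv, ← hv']
    exact H.mem_graph ⟨P w, hd'⟩
  rw [map_add, map_smul, hu] at h2
  have h3 := H.graph.sub_mem h2 h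
  rw [Prod.mk_sub_mk, add_sub_add_left_eq_sub, ← smul_sub] at h3
  exact sub_eq_zero.1 (eq_zero_of_mem_graph_smul hH hz h3)

/-- Pairing `(H - z) w = u` with `w` and using `(H w, w) ≤ μ ‖w‖²` gives `(Re z - μ) ‖w‖² ≤ -Re (w,
u) ≤ ‖w‖ ‖u‖`. -/
theorem norm_resolventOp_le (hm : Measurable m) (hH : Diagonalizes U m H) {μ : ℝ} {P : 𝓗 →L[ℂ] 𝓗}
    (hP : ReducesBelow H μ P) {z : ℂ} (hz : z.im ≠ 0) {u : 𝓗} (hu : P u = u) :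
    (z.re - μ) * ‖resolventOp U hm hz u‖ ≤ ‖u‖ := by
  have hf := resolventOp_fixed hm hH hP hz hu
  set w := resolventOp U hm hz u with hw
  have h := resolventOp_mem_graph hm hH hz u
  rw [← hw] at h
  obtain ⟨hd, hv⟩ := graph_mem_domain h
  have h1 := hP.le ⟨w, hd⟩ hf
  rw [hv] at h1
  simp only [inner_add_right, inner_smul_right, inner_self_eq_norm_sq_to_K, Complex.add_re] at h1
  have h2 : (z * (((‖w‖ : ℝ) : ℂ)) ^ 2).re = z.re * ‖w‖ ^ 2 := by
    rw [← Complex.ofReal_pow, Complex.re_mul_ofReal]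
  have h3 : -(‖w‖ * ‖u‖) ≤ (inner ℂ w u).re :=
    (abs_le.1 ((Complex.abs_re_le_norm _).trans (norm_inner_le_norm w u))).1
  have h4 : (inner ℂ w u).re + z.re * ‖w‖ ^ 2 ≤ μ * ‖w‖ ^ 2 := by
    rw [← h2]
    exact h1
  rcases (norm_nonneg w).eq_or_lt with h0 | h0
  · rw [← h0, mul_zero]
    exact norm_nonneg u
  · refine le_of_mul_le_mul_left ?_ h0
    nlinarith

theorem iterate_resolventOp (hm : Measurable m) (hH : Diagonalizes U m H) {μ : ℝ} {P : 𝓗 →L[ℂ] 𝓗}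
    (hP : ReducesBelow H μ P) {z : ℂ} (hz : z.im ≠ 0) (hμ : μ < z.re) {u : 𝓗} (hu : P u = u)
    (k : ℕ) : ∃ w : 𝓗, P w = w ∧ ‖w‖ ≤ ((z.re - μ)⁻¹) ^ k * ‖u‖ ∧
      U w =ᵐ[ν] fun x => (((m x : ℂ) - z)⁻¹) ^ k * U u x := by
  induction k with
  | zero => exact ⟨u, hu, by simp, by simp⟩
  | succ k ih =>
    obtain ⟨w, h1, h2, h3⟩ := ih
    refine ⟨resolventOp U hm hz w, resolventOp_fixed hm hH hP hz h1, ?_, ?_⟩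
    · have h4 := norm_resolventOp_le hm hH hP hz h1
      have h5 : 0 < z.re - μ := sub_pos.2 hμ
      rw [pow_succ', mul_assoc, inv_mul_eq_div (z.re - μ), le_div_iff₀' h5]
      exact h4.trans h2
    · filter_upwards [h3, resolventOp_ae_eq hm hz w (U := U)] with x k1 k2
      rw [k2, k1]
      ring

/-- On the disc the `k`-th resolvent power multiplies by at least `q^(-k)` in modulus, while its
norm on the range of `P` is at most `(Re z - μ)^(-k)`. The mass on the disc is therefore at most `(q
/ (Re z - μ))^k ‖u‖`, which tends to zero. -/
theorem ae_eq_zero_near (hm : Measurable m) (hH : Diagonalizes U m H) {μ : ℝ} {P : 𝓗 →L[ℂ] 𝓗}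
    (hP : ReducesBelow H μ P) {z : ℂ} (hz : z.im ≠ 0) {u : 𝓗} (hu : P u = u) {q : ℝ} (hq : 0 < q)
    (hqμ : q < z.re - μ) : ∀ᵐ x ∂ν, ‖(m x : ℂ) - z‖ ≤ q → U u x = 0 := by
  let b : α → ℂ := {x | ‖(m x : ℂ) - z‖ ≤ q}.indicator 1
  have hS : MeasurableSet {x | ‖(m x : ℂ) - z‖ ≤ q} :=
    measurableSet_le ((Complex.measurable_ofReal.comp hm).sub_const z).norm measurable_const
  have hb : Measurable b := measurable_one.indicator hS
  have hb1 : ∀ x, ‖b x‖ ≤ 1 := fun x => by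
    by_cases h : ‖(m x : ℂ) - z‖ ≤ q <;> simp [b, h]
  have key : ∀ k : ℕ, ‖mulOp b hb 1 hb1 (U u)‖ ≤ (q * (z.re - μ)⁻¹) ^ k * ‖u‖ := by
    intro k
    obtain ⟨w, -, h2, h3⟩ := iterate_resolventOp hm hH hP hz (by linarith) hu k
    have h4 : ‖mulOp b hb 1 hb1 (U u)‖ ≤ q ^ k * ‖U w‖ := by
      refine Lp.norm_le_mul_norm_of_ae_le_mul ?_
      filter_upwards [mulOp_ae_eq b hb 1 hb1 (U u), h3] with x k1 k2
      rw [k1, k2]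
      by_cases h : ‖(m x : ℂ) - z‖ ≤ q
      · have hpos : 0 < ‖(m x : ℂ) - z‖ := norm_pos_iff.2 (sub_ne_zero_of_im _ hz)
        have : 1 ≤ q ^ k * (‖(m x : ℂ) - z‖⁻¹) ^ k := by
          rw [← mul_pow]
          refine one_le_pow₀ ?_
          rw [← div_eq_mul_inv, one_le_div hpos]
          exact h
        simp only [b, Set.indicator, Set.mem_ofPred_eq, h, if_true, Pi.one_apply, one_mul, norm_mul,
          norm_pow, norm_inv]
        rw [← mul_assoc]
        exact le_mul_of_one_le_left (norm_nonneg _) this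
      · simp only [b, Set.indicator, Set.mem_ofPred_eq, h, if_false, zero_mul, norm_zero]
        positivity
    rw [U.norm_map] at h4
    refine h4.trans ?_
    rw [mul_pow, mul_assoc]
    exact mul_le_mul_of_nonneg_left h2 (by positivity)
  have h0 : mulOp b hb 1 hb1 (U u) = 0 := by
    rw [← norm_le_zero_iff]
    refine ge_of_tendsto' (x := Filter.atTop) (f := fun k : ℕ => (q * (z.re - μ)⁻¹) ^ k * ‖u‖)
      ?_ key
    have := tendsto_pow_atTop_nhds_zero_of_lt_one (r := q * (z.re - μ)⁻¹)
      (by have : 0 < z.re - μ := by linarith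
          positivity)
      (by rw [← div_eq_mul_inv, div_lt_one (by linarith)]; exact hqμ)
    simpa using this.mul_const ‖u‖
  have h1 := mulOp_ae_eq b hb 1 hb1 (U u)
  rw [h0] at h1
  filter_upwards [h1, Lp.coeFn_zero ℂ 2 ν] with x k1 k2 hx
  rw [k2] at k1
  simpa [b, hx] using k1.symm

/-- Large discs almost tangent to the line `Re = μ` exhaust the half-line `(μ, ∞)`. Centres `μ + N +
1 + i` and rational radii keep the family countable; the imaginary part `1` makes the resolvent
available. -/
theorem ae_eq_zero_above (hm : Measurable m) (hH : Diagonalizes U m H) {μ : ℝ} {P : 𝓗 →L[ℂ] 𝓗}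
    (hP : ReducesBelow H μ P) {u : 𝓗} (hu : P u = u) : ∀ᵐ x ∂ν, μ < m x → U u x = 0 := by
  have key : ∀ᵐ x ∂ν, ∀ p : ℕ × ℚ, 0 < (p.2 : ℝ) → (p.2 : ℝ) < (p.1 + 1 : ℝ) →
      ‖(m x : ℂ) - (((μ + (p.1 + 1 : ℝ) : ℝ) : ℂ) + Complex.I)‖ ≤ p.2 → U u x = 0 := by
    rw [ae_all_iff]
    rintro ⟨N, q⟩
    by_cases h1 : 0 < (q : ℝ)
    · by_cases h2 : (q : ℝ) < (N + 1 : ℝ)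
      · filter_upwards [ae_eq_zero_near hm hH hP (z := ((μ + (N + 1 : ℝ) : ℝ) : ℂ) + Complex.I)
          (by simp) hu h1 (by simpa using h2)] with x hx _ _ using hx
      · exact Filter.Eventually.of_forall fun x _ h => absurd h h2
    · exact Filter.Eventually.of_forall fun x h => absurd h h1
  filter_upwards [key] with x hx hμ
  -- With `s = m x - μ`, the point lies within `N + 1` of the centre exactly when `s² + 1 < 2s(N +
  -- 1)`.
  obtain ⟨N, hN⟩ := exists_nat_gt (((m x - μ) ^ 2 + 1) / (2 * (m x - μ)))
  have hs : 0 < m x - μ := sub_pos.2 hμ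
  rw [div_lt_iff₀ (by positivity)] at hN
  have hlt : ‖(m x : ℂ) - (((μ + (N + 1 : ℝ) : ℝ) : ℂ) + Complex.I)‖ < (N + 1 : ℝ) := by
    rw [← abs_of_nonneg (norm_nonneg _)]
    refine abs_lt_of_sq_lt_sq ?_ (by positivity)
    rw [Complex.sq_norm, Complex.normSq_apply]
    simp only [Complex.sub_re, Complex.add_re, Complex.ofReal_re, Complex.I_re, Complex.sub_im,
      Complex.add_im, Complex.ofReal_im, Complex.I_im]
    nlinarith
  obtain ⟨q, hq1, hq2⟩ := exists_rat_btwn hlt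
  exact hx (N, q) ((norm_nonneg _).trans_lt hq1) hq2 hq1.le

theorem range_le_range_spectralProj (hm : Measurable m) (hH : Diagonalizes U m H) {μ : ℝ}
    {P : 𝓗 →L[ℂ] 𝓗} (hP : ReducesBelow H μ P) :
    LinearMap.range (P : 𝓗 →ₗ[ℂ] 𝓗) ≤ LinearMap.range (spectralProj U hm μ : 𝓗 →ₗ[ℂ] 𝓗) := by
  rintro _ ⟨v, rfl⟩
  set u := P v with hu
  have hPu : P u = u := by
    have := congrArg (fun T : 𝓗 →L[ℂ] 𝓗 => T v) hP.isStarProjection.isIdempotentElem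
    exact this
  refine ⟨u, ?_⟩
  apply U.injective
  refine Lp.ext ?_
  simp only [ContinuousLinearMap.coe_coe]
  filter_upwards [spectralProj_ae_eq hm μ u (U := U), ae_eq_zero_above hm hH hP hPu] with x h1 h2
  rw [← hu, h1]
  by_cases h : m x ≤ μ
  · simp [belowSymbol, h]
  · rw [h2 (not_le.1 h), mul_zero]

theorem isSpectralFamily_spectralProj (hm : Measurable m) (hH : Diagonalizes U m H) :
    IsSpectralFamily H (spectralProj U hm) :=
  fun μ => ⟨reducesBelow_spectralProj hm hH μ, fun _ hP => range_le_range_spectralProj hm hH hP⟩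

/-! ### Uniqueness of the spectral family -/

/-- Each projection fixes the range of the other, so `Q P = P` and `P Q = Q`; the adjoint of the
first identity is `P Q = P`. -/
theorem eq_of_range_eq {P Q : 𝓗 →L[ℂ] 𝓗} (hP : IsStarProjection P) (hQ : IsStarProjection Q)
    (h : LinearMap.range (P : 𝓗 →ₗ[ℂ] 𝓗) = LinearMap.range (Q : 𝓗 →ₗ[ℂ] 𝓗)) : P = Q := by
  have fix : ∀ {P Q : 𝓗 →L[ℂ] 𝓗}, IsStarProjection Q →
      LinearMap.range (P : 𝓗 →ₗ[ℂ] 𝓗) ≤ LinearMap.range (Q : 𝓗 →ₗ[ℂ] 𝓗) → Q * P = P := by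
    intro P Q hQ h
    ext v
    obtain ⟨w, hw⟩ := h ⟨v, rfl⟩
    simp only [ContinuousLinearMap.coe_coe] at hw
    rw [mul_apply_eq_comp, ← hw]
    exact congrArg (fun T : 𝓗 →L[ℂ] 𝓗 => T w) hQ.isIdempotentElem
  have h1 : Q * P = P := fix hQ h.le
  have h2 : P * Q = Q := fix hP h.ge
  have h3 := congrArg star h1
  rw [star_mul, hP.isSelfAdjoint.star_eq, hQ.isSelfAdjoint.star_eq] at h3
  rw [← h3, h2]

theorem IsSpectralFamily.unique {E E' : ℝ → 𝓗 →L[ℂ] 𝓗} (h : IsSpectralFamily H E)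
    (h' : IsSpectralFamily H E') : E = E' := by
  funext μ
  refine eq_of_range_eq (h μ).1.isStarProjection (h' μ).1.isStarProjection (le_antisymm ?_ ?_)
  · exact (h' μ).2 _ (h μ).1
  · exact (h μ).2 _ (h' μ).1

/-! ### Self-adjointness of diagonalized operators -/

/-- A vector `g` orthogonal to the domain is orthogonal to its own resolvent at `i`, and the
imaginary part of that inner product is `-∫ |U g|² / (m² + 1)`. -/
theorem Diagonalizes.dense_domain (hm : Measurable m) (hH : Diagonalizes U m H) :
    Dense (H.domain : Set 𝓗) := by
  have hI : Complex.I.im ≠ 0 := by simp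
  rw [Submodule.dense_iff_topologicalClosure_eq_top, Submodule.topologicalClosure_eq_top_iff,
    Submodule.eq_bot_iff]
  intro g hg
  have h1 : inner ℂ (resolventOp U hm hI g) g = 0 :=
    hg _ (graph_mem_domain (resolventOp_mem_graph hm hH hI g)).1
  rw [← U.inner_map_map, L2.inner_def] at h1
  have hi := L2.integrable_inner (𝕜 := ℂ) (U (resolventOp U hm hI g)) (U g)
  have h2 := integral_im hi
  rw [h1, map_zero] at h2
  have e : (fun x => RCLike.im (inner ℂ (U (resolventOp U hm hI g) x) (U g x)))
      =ᵐ[ν] fun x => - (((m x ^ 2 + 1)⁻¹) * ‖U g x‖ ^ 2) := by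
    filter_upwards [resolventOp_ae_eq hm hI g (U := U)] with x hx
    rw [hx, RCLike.inner_apply, map_mul (starRingEnd ℂ), mul_left_comm, Complex.mul_conj, ← Complex.sq_norm,
      RCLike.im_eq_complex_im, Complex.im_mul_ofReal, Complex.conj_im, Complex.inv_im,
      Complex.normSq_apply]
    simp only [Complex.sub_im, Complex.ofReal_im, Complex.I_im, zero_sub, Complex.sub_re,
      Complex.ofReal_re, Complex.I_re, sub_zero]
    ring
  rw [integral_congr_ae e, integral_neg, neg_eq_zero, integral_eq_zero_iff_of_nonneg] at h2
  · have : U g = 0 := by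
      refine Lp.ext ?_
      filter_upwards [h2, Lp.coeFn_zero ℂ 2 ν] with x hx h0
      rw [h0]
      have hpos : 0 < m x ^ 2 + 1 := by positivity
      simpa [hpos.ne'] using hx
    simpa using this
  · intro x
    simp only [Pi.zero_apply]
    positivity
  · have := (hi.im.congr e).neg
    simpa using! this

/-- An adjoint pair `(f, g)` is tested on the graph points `(R w, w + i R w)`, with `R` the
resolvent at `i`. Moving `R` across as multiplication by `(m + i)⁻¹` gives `(m + i)⁻¹ U g = U f - i
(m + i)⁻¹ U f`, that is, `U g = m U f`. -/
theorem Diagonalizes.isSelfAdjoint (hm : Measurable m) (hH : Diagonalizes U m H) :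
    IsSelfAdjoint H := by
  have hI : Complex.I.im ≠ 0 := by simp
  rw [LinearPMap.isSelfAdjoint_def]
  refine LinearPMap.eq_of_eq_graph ?_
  rw [LinearPMap.adjoint_graph_eq_graph_adjoint (hH.dense_domain hm)]
  ext ⟨f, g⟩
  rw [Submodule.mem_adjoint_iff]
  constructor
  · intro h
    refine (hH _ _).2 ?_
    have h1 : ∀ w : 𝓗, inner ℂ (U w) (mulResolvent ν hm (z := -Complex.I) (by simp) (U g)
        - (U f - Complex.I • mulResolvent ν hm (z := -Complex.I) (by simp) (U f))) = 0 := by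
      intro w
      have h2 := h _ _ (resolventOp_mem_graph hm hH hI w)
      simp only [← U.inner_map_map (_ : 𝓗) f, ← U.inner_map_map (_ : 𝓗) g, map_add, map_smul,
        inner_add_left, inner_smul_left] at h2
      have h3 : ∀ v : 𝓗, inner ℂ (U (resolventOp U hm hI w)) (U v)
          = inner ℂ (U w) (mulResolvent ν hm (z := -Complex.I) (by simp) (U v)) := by
        intro v
        rw [Lp_inner_eq, Lp_inner_eq]
        refine integral_congr_ae ?_
        filter_upwards [resolventOp_ae_eq hm hI w (U := U),
          mulResolvent_ae_eq hm (z := -Complex.I) (by simp) (U v)] with x k1 k2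
        rw [k1, k2, map_mul, map_inv₀, map_sub, Complex.conj_ofReal, Complex.conj_I]
        ring
      rw [h3, h3] at h2
      rw [inner_sub_right, inner_sub_right, inner_smul_right]
      simp only [Complex.conj_I] at h2
      linear_combination -h2
    have h2 := h1 (U.symm (mulResolvent ν hm (z := -Complex.I) (by simp) (U g)
        - (U f - Complex.I • mulResolvent ν hm (z := -Complex.I) (by simp) (U f))))
    rw [U.apply_symm_apply, inner_self_eq_zero, sub_eq_zero] at h2
    have h3 := congrArg (fun T : Lp ℂ 2 ν => (T : α → ℂ)) h2
    filter_upwards [Filter.EventuallyEq.of_eq h3,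
      mulResolvent_ae_eq hm (z := -Complex.I) (by simp) (U f),
      mulResolvent_ae_eq hm (z := -Complex.I) (by simp) (U g),
      Lp.coeFn_sub (U f) (Complex.I • mulResolvent ν hm (z := -Complex.I) (by simp) (U f)),
      Lp.coeFn_smul Complex.I (mulResolvent ν hm (z := -Complex.I) (by simp) (U f))]
      with x k1 k2 k3 k4 k5
    simp only [k4, k5, k2, k3, Pi.sub_apply, Pi.smul_apply, smul_eq_mul] at k1
    have hne := sub_ne_zero_of_im (m x) (z := -Complex.I) (by simp)
    field_simp at k1
    rw [k1]
    ring
  · intro h a b hab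
    have h1 := (hH _ _).1 h
    have h2 := (hH _ _).1 hab
    simp only
    rw [sub_eq_zero, ← U.inner_map_map, ← U.inner_map_map, Lp_inner_eq, Lp_inner_eq]
    refine integral_congr_ae ?_
    filter_upwards [h1, h2] with x k1 k2
    rw [k1, k2, map_mul, Complex.conj_ofReal]
    ring

end Diagonal
end ShearFlow
end

noncomputable section

namespace ShearFlow

/-! ### Cores of multiplication operators -/

section Core

variable {α : Type*} [MeasurableSpace α] {ν : Measure α}
variable {𝓗 : Type*} [NormedAddCommGroup 𝓗] [InnerProductSpace ℂ 𝓗]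
variable {U : 𝓗 ≃ₗᵢ[ℂ] Lp ℂ 2 ν} {m : α → ℝ}

theorem I_im_ne_zero : Complex.I.im ≠ 0 := by simp

variable (U) in
/-- The parametrization `w ↦ (R w, w + i R w)` of the graph of the multiplication by `m`, with `R`
the resolvent at `i`. -/
def graphParam (hm : Measurable m) : 𝓗 →L[ℂ] 𝓗 × 𝓗 :=
  (resolventOp U hm I_im_ne_zero).prod
    (ContinuousLinearMap.id ℂ 𝓗 + Complex.I • resolventOp U hm I_im_ne_zero)

theorem graphParam_apply (hm : Measurable m) (w : 𝓗) :
    graphParam U hm w = (resolventOp U hm I_im_ne_zero w,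
      w + Complex.I • resolventOp U hm I_im_ne_zero w) := rfl

theorem graphParam_ae_eq (hm : Measurable m) (w : 𝓗) :
    U (graphParam U hm w).2 =ᵐ[ν] fun x => (m x : ℂ) * U (graphParam U hm w).1 x := by
  rw [graphParam_apply]
  simp only [map_add, map_smul]
  filter_upwards [Lp.coeFn_add (U w) (Complex.I • U (resolventOp U hm I_im_ne_zero w)),
    Lp.coeFn_smul Complex.I (U (resolventOp U hm I_im_ne_zero w)),
    resolventOp_ae_eq hm I_im_ne_zero w (U := U)] with x h1 h2 h3
  rw [h1, Pi.add_apply, h2, Pi.smul_apply, h3, smul_eq_mul]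
  field_simp [sub_ne_zero_of_im (m x) I_im_ne_zero]
  ring

theorem graphParam_sub (hm : Measurable m) {u v : 𝓗}
    (h : U v =ᵐ[ν] fun x => (m x : ℂ) * U u x) : graphParam U hm (v - Complex.I • u) = (u, v) := by
  have h1 : resolventOp U hm I_im_ne_zero (v - Complex.I • u) = u := by
    apply U.injective
    refine Lp.ext ?_
    filter_upwards [h, resolventOp_ae_eq hm I_im_ne_zero (v - Complex.I • u) (U := U),
      Filter.EventuallyEq.of_eq (congrArg (fun T : Lp ℂ 2 ν => (T : α → ℂ))
        (show U (v - Complex.I • u) = U v - Complex.I • U u by rw [map_sub, map_smul])),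
      Lp.coeFn_sub (U v) (Complex.I • U u), Lp.coeFn_smul Complex.I (U u)] with x k1 k2 k3 k4 k5
    rw [k2, k3, k4, Pi.sub_apply, k5, Pi.smul_apply, k1, smul_eq_mul, ← sub_mul,
      inv_mul_cancel_left₀ (sub_ne_zero_of_im (m x) I_im_ne_zero)]
  rw [graphParam_apply, h1, sub_add_cancel]

/-- The map `(u, v) ↦ v - i u` inverts `graphParam` continuously on the maximal graph. That graph is
therefore closed and homeomorphic to the whole space, so density of the image of `T` is density of
`T` in it. -/
theorem topologicalClosure_eq_range_graphParam (hm : Measurable m) {T : Submodule ℂ (𝓗 × 𝓗)}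
    (hT : ∀ p ∈ T, U p.2 =ᵐ[ν] fun x => (m x : ℂ) * U p.1 x)
    (hd : Dense ((fun p : 𝓗 × 𝓗 => p.2 - Complex.I • p.1) '' (T : Set (𝓗 × 𝓗)))) :
    T.topologicalClosure = LinearMap.range (graphParam U hm : 𝓗 →ₗ[ℂ] 𝓗 × 𝓗) := by
  apply SetLike.coe_injective
  rw [Submodule.topologicalClosure_coe]
  refine subset_antisymm ?_ ?_
  · have hc : IsClosed {p : 𝓗 × 𝓗 | graphParam U hm (p.2 - Complex.I • p.1) = p} :=
      isClosed_eq (by fun_prop) continuous_id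
    have h1 : (T : Set (𝓗 × 𝓗)) ⊆ {p : 𝓗 × 𝓗 | graphParam U hm (p.2 - Complex.I • p.1) = p} :=
      fun p hp => graphParam_sub hm (hT p hp)
    exact (closure_minimal h1 hc).trans fun p hp => ⟨_, hp⟩
  · rintro _ ⟨w, rfl⟩
    refine map_mem_closure (graphParam U hm).continuous (hd w) ?_
    rintro _ ⟨p, hp, rfl⟩
    have := graphParam_sub hm (hT p hp)
    simp only [ContinuousLinearMap.coe_coe]
    rw [this]
    exact hp

theorem diagonalizes_closure (hm : Measurable m) {T : 𝓗 →ₗ.[ℂ] 𝓗}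
    (hT : ∀ p ∈ T.graph, U p.2 =ᵐ[ν] fun x => (m x : ℂ) * U p.1 x)
    (hd : Dense ((fun p : 𝓗 × 𝓗 => p.2 - Complex.I • p.1) '' (T.graph : Set (𝓗 × 𝓗)))) :
    Diagonalizes U m T.closure := by
  have h := topologicalClosure_eq_range_graphParam hm hT hd
  -- Closability has to be proved, since `LinearPMap.closure` returns the operator itself when it
  -- fails.
  have hf : ∀ p ∈ T.graph.topologicalClosure, p.1 = 0 → p.2 = 0 := by
    intro p hp h0
    rw [h] at hp
    obtain ⟨w, rfl⟩ := hp
    have h1 := graphParam_ae_eq hm w (U := U)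
    simp only [ContinuousLinearMap.coe_coe] at h0 ⊢
    rw [h0, map_zero] at h1
    have : U (graphParam U hm w).2 = 0 := by
      refine Lp.ext ?_
      filter_upwards [h1, Lp.coeFn_zero ℂ 2 ν] with x k1 k2
      rw [k1, k2, Pi.zero_apply, mul_zero]
    simpa using this
  have hcl : T.IsClosable :=
    ⟨T.graph.topologicalClosure.toLinearPMap, (Submodule.toLinearPMap_graph_eq _ hf).symm⟩
  intro u v
  rw [← hcl.graph_closure_eq_closure_graph, h]
  constructor
  · rintro ⟨w, hw⟩
    have h1 := graphParam_ae_eq hm w (U := U)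
    simp only [ContinuousLinearMap.coe_coe] at hw
    rw [hw] at h1
    exact h1
  · intro huv
    exact ⟨_, graphParam_sub hm huv⟩

end Core

/-! ### The shear flow operator in the Fourier representation -/

section Symbol

open scoped FourierTransform

variable {n : ℕ}

/-- The symbol `2 π k ψ(x')` of the shear flow operator. -/
def shearSymbol (ψ : EuclideanSpace ℝ (Fin n) → ℝ) (x : Space n) : ℝ :=
  2 * Real.pi * x.1 * ψ x.2

theorem measurable_shearSymbol {ψ : EuclideanSpace ℝ (Fin n) → ℝ} (hψ : Continuous ψ) :
    Measurable (shearSymbol ψ) := by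
  unfold shearSymbol
  fun_prop

theorem isClosedEmbedding_fibre (y : EuclideanSpace ℝ (Fin n)) :
    Topology.IsClosedEmbedding fun t : ℝ => ((t, y) : Space n) :=
  (Isometry.of_dist_eq fun s t => by simp [Prod.dist_eq]).isClosedEmbedding

theorem fourier_const_mul (c : ℂ) (f : ℝ → ℂ) (k : ℝ) :
    𝓕 (fun t => c * f t) k = c * 𝓕 f k := by
  simp only [Real.fourier_eq, ← integral_const_mul]
  congr 1
  ext t
  rw [← smul_eq_mul, ← smul_eq_mul, smul_comm]

theorem testGraph_ae_eq (ψ : EuclideanSpace ℝ (Fin n) → ℝ) {p : L2 n × L2 n}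
    (hp : p ∈ testGraph ψ) :
    fourierUnitary n p.2 =ᵐ[volume] fun x => (shearSymbol ψ x : ℂ) * fourierUnitary n p.1 x := by
  obtain ⟨φ, h1, h2, h3, h4⟩ := hp
  have hs : ∀ y, ContDiff ℝ ∞ fun t : ℝ => φ (t, y) := fun y => h1.comp (by fun_prop)
  have hc : ∀ y, HasCompactSupport fun t : ℝ => φ (t, y) := fun y =>
    h2.comp_isClosedEmbedding (isClosedEmbedding_fibre y)
  have hi : ∀ y, Integrable fun t : ℝ => φ (t, y) := fun y =>
    (hs y).continuous.integrable_of_hasCompactSupport (hc y)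
  have hi' : ∀ y, Integrable (deriv fun t : ℝ => φ (t, y)) := fun y =>
    ((hs y).continuous_deriv (by simp)).integrable_of_hasCompactSupport (hc y).deriv
  have m1 : p.1 ∈ fibreIntegrable n :=
    mem_fibreIntegrable_of_ae_eq h3 (Filter.Eventually.of_forall hi)
  have m2 : p.2 ∈ fibreIntegrable n :=
    mem_fibreIntegrable_of_ae_eq h4 (Filter.Eventually.of_forall fun y =>
      (hi' y).const_mul (-Complex.I * (ψ y : ℂ)))
  refine (fourierUnitary_ae_eq m2).trans ?_
  have key : fibreFourier p.2 =ᵐ[volume]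
      fun x => (shearSymbol ψ x : ℂ) * fibreFourier p.1 x := by
    refine ae_of_ae_snd ?_
    filter_upwards [fibreFourier_congr h3, fibreFourier_congr h4] with y k1 k2 k
    rw [k1, k2]
    simp only [fibreFourier]
    rw [fourier_const_mul, Real.fourier_deriv (hi y) ((hs y).differentiable (by simp)) (hi' y)]
    simp only [shearSymbol, smul_eq_mul]
    push_cast
    linear_combination (-(2 * Real.pi * k * ψ y * 𝓕 (fun t : ℝ => φ (t, y)) k) : ℂ)
      * Complex.I_mul_I
  refine key.trans ?_
  filter_upwards [fourierUnitary_ae_eq m1] with x hx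
  rw [hx]

end Symbol
end ShearFlow
end

noncomputable section

namespace ShearFlow

/-! ### Weak solutions of `g - c g' = 0` -/

section WeakODE

open scoped Convolution

/-- Solutions of `G = c G'` are multiples of `exp (s / c)`, unbounded as `s → ∞` unless zero.
Continuity extends the equation from the rationals, where countably many conditions impose it. -/
theorem eq_zero_of_bounded_of_deriv {G G' : ℝ → ℂ} {c B : ℝ} (hc : 0 < c)
    (hG : ∀ s, HasDerivAt G (G' s) s) (hG' : Continuous G')
    (hode : ∀ q : ℚ, G q = c * G' q) (hB : ∀ s, ‖G s‖ ≤ B) : G = 0 := by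
  have hcont : Continuous G := continuous_iff_continuousAt.2 fun s => (hG s).continuousAt
  have hall : G = fun s => (c : ℂ) * G' s :=
    Rat.denseRange_cast.equalizer hcont (by fun_prop) (funext hode)
  have hc' : (c : ℂ) ≠ 0 := Complex.ofReal_ne_zero.2 hc.ne'
  have hd : ∀ s : ℝ, HasDerivAt (fun s : ℝ => G s * Complex.exp (-(s / c : ℂ))) 0 s := by
    intro s
    have h1 : HasDerivAt (fun s : ℝ => Complex.exp (-(s / c : ℂ)))
        (Complex.exp (-(s / c : ℂ)) * (-(1 / c : ℂ))) s :=
      (((Complex.ofRealCLM.hasDerivAt (x := s)).div_const (c : ℂ)).neg).cexp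
    convert! (hG s).mul h1 using 1
    rw [congrFun hall s]
    field_simp
    ring
  have hconst : ∀ s : ℝ, G s * Complex.exp (-(s / c : ℂ)) = G 0 := by
    intro s
    have := is_const_of_deriv_eq_zero (fun s => (hd s).differentiableAt)
      (fun s => (hd s).deriv) s 0
    simpa using this
  have hle : ∀ s : ℝ, ‖G 0‖ ≤ B * Real.exp (-(s / c)) := by
    intro s
    rw [← hconst s, norm_mul, Complex.norm_exp]
    have e : (-(s / c : ℂ)).re = -(s / c) := by
      rw [← Complex.ofReal_div, ← Complex.ofReal_neg, Complex.ofReal_re]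
    rw [e]
    exact mul_le_mul_of_nonneg_right (hB s) (Real.exp_nonneg _)
  have h0 : G 0 = 0 := by
    rw [← norm_le_zero_iff]
    refine ge_of_tendsto' (x := Filter.atTop) (f := fun s : ℝ => B * Real.exp (-(s / c))) ?_ hle
    have : Filter.Tendsto (fun s : ℝ => Real.exp (-(s / c))) Filter.atTop (nhds 0) :=
      Real.tendsto_exp_neg_atTop_nhds_zero.comp (Filter.tendsto_id.atTop_div_const hc)
    simpa using this.const_mul B
  funext s
  have := hconst s
  rw [h0, mul_eq_zero] at this
  exact this.resolve_right (Complex.exp_ne_zero _)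

/-- A sequence of bump functions on the line with shrinking supports. -/
def lineBump (j : ℕ) : ContDiffBump (0 : ℝ) where
  rIn := 1 / (j + 1)
  rOut := 2 / (j + 1)
  rIn_pos := by positivity
  rIn_lt_rOut := by gcongr; norm_num

/-- The bump functions of integral one. -/
def lineMollifier (j : ℕ) : ℝ → ℝ := (lineBump j).normed volume

theorem contDiff_lineMollifier (j : ℕ) : ContDiff ℝ ∞ (lineMollifier j) :=
  (lineBump j).contDiff_normed

theorem hasCompactSupport_lineMollifier (j : ℕ) : HasCompactSupport (lineMollifier j) :=
  (lineBump j).hasCompactSupport_normed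

theorem norm_integral_comp_sub_mul_le {a : ℝ → ℝ} (ha : Continuous a) (hac : HasCompactSupport a)
    {g : ℝ → ℂ} (hg : MemLp g 2) (s : ℝ) :
    ‖∫ t, a (s - t) • g t‖ ≤ (∫ t, a t ^ 2) + ∫ t, ‖g t‖ ^ 2 := by
  have h1 : Integrable fun t => a t ^ 2 :=
    (ha.pow 2).integrable_of_hasCompactSupport (by simpa only [pow_two] using hac.mul_left)
  have h2 : Integrable fun t => ‖g t‖ ^ 2 := hg.integrable_norm_pow (by norm_num)
  have e : ∫ t, a t ^ 2 = ∫ t, a (s - t) ^ 2 :=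
    (integral_sub_left_eq_self (fun t => a t ^ 2) volume s).symm
  rw [e, ← integral_add (h1.comp_sub_left s) h2]
  refine norm_integral_le_of_norm_le ((h1.comp_sub_left s).add h2)
    (Filter.Eventually.of_forall fun t => ?_)
  rw [norm_smul, Real.norm_eq_abs]
  nlinarith [sq_nonneg (|a (s - t)| - ‖g t‖), sq_abs (a (s - t)), sq_nonneg (a (s - t)),
    sq_nonneg ‖g t‖]

/-- The hypothesis says that each mollification `G = ρ_j * g` satisfies `G = c G'` at rational
points. It is bounded because `g` is in `L²`, hence zero, and the mollifications converge to `g`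
almost everywhere. -/
theorem ae_eq_zero_of_weak_ode {g : ℝ → ℂ} (hg : MemLp g 2) {c : ℝ} (hc : 0 < c)
    (h : ∀ (j : ℕ) (q : ℚ),
      ∫ t, (lineMollifier j (q - t) - c * deriv (lineMollifier j) (q - t)) • g t = 0) :
    g =ᵐ[volume] 0 := by
  have hloc : LocallyIntegrable g volume := hg.locallyIntegrable (by norm_num)
  have hzero : ∀ j : ℕ, (lineMollifier j ⋆[ContinuousLinearMap.lsmul ℝ ℝ, volume] g) = 0 := by
    intro j
    have hρ := contDiff_lineMollifier j
    have hρc := hasCompactSupport_lineMollifier j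
    have swap : ∀ (a : ℝ → ℝ) (s : ℝ),
        (a ⋆[ContinuousLinearMap.lsmul ℝ ℝ, volume] g) s = ∫ t, a (s - t) • g t := by
      intro a s
      rw [convolution_eq_swap]
      rfl
    have hint : ∀ (a : ℝ → ℝ), Continuous a → HasCompactSupport a → ∀ s : ℝ,
        Integrable fun t => a (s - t) • g t := by
      intro a ha hac s
      exact hloc.integrable_smul_left_of_hasCompactSupport (by fun_prop)
        (hac.comp_homeomorph (Homeomorph.subLeft s))
    have hd : Continuous (deriv (lineMollifier j)) := hρ.continuous_deriv (by simp)
    refine eq_zero_of_bounded_of_deriv hc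
      (B := (∫ t, lineMollifier j t ^ 2) + ∫ t, ‖g t‖ ^ 2) (G' := deriv (lineMollifier j)
      ⋆[ContinuousLinearMap.lsmul ℝ ℝ, volume] g) (fun s => ?_) ?_ (fun q => ?_) (fun s => ?_)
    · exact hρc.hasDerivAt_convolution_left _ (hρ.of_le (by simp)) hloc s
    · exact hρc.deriv.continuous_convolution_left _ hd hloc
    · have := h j q
      simp only [sub_smul, mul_smul] at this
      replace this :=
        (integral_sub (hint _ hρ.continuous hρc q) ((hint _ hd hρc.deriv q).smul c)).symm.trans this
      rw [sub_eq_zero] at this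
      simp only [Pi.smul_apply] at this
      rw [swap, swap, this, integral_smul, Complex.real_smul]
    · rw [swap]
      exact norm_integral_comp_sub_mul_le hρ.continuous hρc hg s
  -- Here `K = 2` is the ratio of outer to inner radius of `lineBump`.
  have key := ContDiffBump.ae_convolution_tendsto_right_of_locallyIntegrable
    (φ := lineBump) (l := Filter.atTop) (K := 2) (μ := volume) (g := g) ?_ ?_ hloc
  · filter_upwards [key] with x hx
    refine tendsto_nhds_unique hx ?_
    have : ∀ j, ((lineBump j).normed volume ⋆[ContinuousLinearMap.lsmul ℝ ℝ, volume] g) x = 0 :=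
      fun j => congrFun (hzero j) x
    simp only [this, Pi.zero_apply]
    exact tendsto_const_nhds
  · simp only [lineBump]
    exact tendsto_const_nhds.div_atTop
      (Filter.tendsto_atTop_add_const_right _ _ tendsto_natCast_atTop_atTop)
  · refine Filter.Eventually.of_forall fun j => le_of_eq ?_
    simp only [lineBump]
    ring

end WeakODE

/-! ### Density of the range of `-i ψ ∂₁ - i` -/

section Density

variable {n : ℕ}

theorem locallyIntegrable_fibre_integral {a : ℝ → ℝ} (ha : Continuous a)
    (hac : HasCompactSupport a) (g : L2 n) :
    LocallyIntegrable (fun y : EuclideanSpace ℝ (Fin n) => ∫ t : ℝ, a t • g (t, y)) volume := by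
  rw [locallyIntegrable_iff]
  intro K hK
  rw [← integrable_indicator_iff hK.measurableSet]
  have h1 : MemLp (fun x : Space n => (a x.1 * K.indicator (fun _ => (1 : ℝ)) x.2)) 2 volume := by
    have hm : AEStronglyMeasurable
        (fun x : Space n => (a x.1 * K.indicator (fun _ => (1 : ℝ)) x.2)) volume := by
      have : Measurable (K.indicator (fun _ => (1 : ℝ))) :=
        measurable_const.indicator hK.measurableSet
      have ha' := ha.measurable
      exact Measurable.aestronglyMeasurable (by fun_prop)
    rw [memLp_two_iff_integrable_sq hm]
    have i1 : Integrable fun t => a t ^ 2 :=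
      (ha.pow 2).integrable_of_hasCompactSupport (by simpa only [pow_two] using hac.mul_left)
    have i2 : Integrable (K.indicator (fun _ => (1 : ℝ))) :=
      (integrable_indicator_iff hK.measurableSet).2 (integrableOn_const hK.measure_lt_top.ne)
    refine (i1.mul_prod i2).congr (Filter.Eventually.of_forall fun x => ?_)
    simp only
    by_cases h : x.2 ∈ K <;> simp [h]
  have h2 : Integrable (fun x : Space n =>
      (a x.1 * K.indicator (fun _ => (1 : ℝ)) x.2) • g x) volume :=
    memLp_one_iff_integrable.1 ((Lp.memLp g).smul h1)
  refine h2.integral_prod_right.congr (Filter.Eventually.of_forall fun y => ?_)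
  simp only
  by_cases h : y ∈ K <;> simp [h]

theorem integrable_fibre_smul {a : ℝ → ℝ} (ha : Continuous a) (hac : HasCompactSupport a)
    (g : L2 n) : ∀ᵐ y : EuclideanSpace ℝ (Fin n), Integrable fun t : ℝ => a t • g (t, y) := by
  filter_upwards [memLp_fibre (Lp.memLp g)] with y hy
  exact (hy.locallyIntegrable (by norm_num)).integrable_smul_left_of_hasCompactSupport ha hac

/-- Orthogonality is tested on products `a(x₁) b(x')`. Since `b` is arbitrary, the fibre integral
vanishes for almost every `y`, with an exceptional set that depends on `a`. -/
theorem ae_integral_fibre_eq_zero {ψ : EuclideanSpace ℝ (Fin n) → ℝ} (hψ : Continuous ψ)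
    {g : L2 n} (hg : ∀ p ∈ testGraph ψ, inner ℂ (p.2 - Complex.I • p.1) g = 0) {a : ℝ → ℝ}
    (ha : ContDiff ℝ ∞ a) (hac : HasCompactSupport a) :
    ∀ᵐ y : EuclideanSpace ℝ (Fin n), ∫ t : ℝ, (a t + ψ y * deriv a t) • g (t, y) = 0 := by
  have hd : Continuous (deriv a) := ha.continuous_deriv (by simp)
  have hsplit : ∀ᵐ y : EuclideanSpace ℝ (Fin n), ∫ t : ℝ, (a t + ψ y * deriv a t) • g (t, y)
      = (∫ t : ℝ, a t • g (t, y)) + ψ y • ∫ t : ℝ, deriv a t • g (t, y) := by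
    filter_upwards [integrable_fibre_smul ha.continuous hac g,
      integrable_fibre_smul hd hac.deriv g] with y h1 h2
    simp only [add_smul, mul_smul]
    rw [← integral_smul]
    exact integral_add h1 (h2.smul (ψ y))
  have hloc : LocallyIntegrable (fun y : EuclideanSpace ℝ (Fin n) =>
      (∫ t : ℝ, a t • g (t, y)) + ψ y • ∫ t : ℝ, deriv a t • g (t, y)) volume :=
    (locallyIntegrable_fibre_integral ha.continuous hac g).add
      ((locallyIntegrable_fibre_integral hd hac.deriv g).continuous_smul hψ)
  have key := ae_eq_zero_of_integral_contDiff_smul_eq_zero hloc ?_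
  · filter_upwards [key, hsplit] with y h1 h2
    rw [h2, h1]
  intro b hb hbc
  have hφ : ContDiff ℝ ∞ fun x : Space n => (a x.1 : ℂ) * (b x.2 : ℂ) :=
    (Complex.ofRealCLM.contDiff.comp (ha.comp contDiff_fst)).mul
      (Complex.ofRealCLM.contDiff.comp (hb.comp contDiff_snd))
  have hcs : ∀ (a' : ℝ → ℝ), HasCompactSupport a' → ∀ w : Space n → ℂ,
      (∀ x, a' x.1 = 0 → w x = 0) → (∀ x, b x.2 = 0 → w x = 0) → HasCompactSupport w := by
    intro a' ha' w h1 h2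
    refine HasCompactSupport.intro (K := tsupport a' ×ˢ tsupport b)
      (ha'.isCompact.prod hbc.isCompact) fun x hx => ?_
    rw [Set.mem_prod, not_and_or] at hx
    rcases hx with hx | hx
    · exact h1 x (image_eq_zero_of_notMem_tsupport hx)
    · exact h2 x (image_eq_zero_of_notMem_tsupport hx)
  have hφc : HasCompactSupport fun x : Space n => (a x.1 : ℂ) * (b x.2 : ℂ) :=
    hcs a hac _ (fun x hx => by simp [hx]) (fun x hx => by simp [hx])
  let w : Space n → ℂ := fun x => -Complex.I * (ψ x.2 : ℂ) * (((deriv a x.1 : ℝ) : ℂ) * (b x.2 : ℂ))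
  have hb' := hb.continuous
  have hw : Continuous w := by fun_prop
  have hwc : HasCompactSupport w :=
    hcs (deriv a) hac.deriv _ (fun x hx => by simp [w, hx]) (fun x hx => by simp [w, hx])
  have m1 : MemLp (fun x : Space n => (a x.1 : ℂ) * (b x.2 : ℂ)) 2 volume :=
    hφ.continuous.memLp_of_hasCompactSupport hφc
  have m2 : MemLp w 2 volume := hw.memLp_of_hasCompactSupport hwc
  have hmem : (m1.toLp _, m2.toLp _) ∈ testGraph ψ := by
    refine ⟨_, hφ, hφc, m1.coeFn_toLp, m2.coeFn_toLp.trans (Filter.Eventually.of_forall fun x => ?_)⟩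
    have hda : HasDerivAt (fun t : ℝ => (a t : ℂ) * (b x.2 : ℂ)) (((deriv a x.1 : ℝ) : ℂ) * (b x.2 : ℂ))
        x.1 := by
      have := ((ha.differentiable (by simp)) x.1).hasDerivAt
      exact this.ofReal_comp.mul_const _
    simp only [w]
    rw [hda.deriv]
  have h0 := hg _ hmem
  have hpt : (fun x : Space n => conj ((m2.toLp w - Complex.I • m1.toLp _ : L2 n) x) * g x)
      =ᵐ[volume] fun x => Complex.I * (b x.2 • ((a x.1 + ψ x.2 * deriv a x.1) • g x)) := by
    filter_upwards [Lp.coeFn_sub (m2.toLp w) (Complex.I • m1.toLp _),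
      Lp.coeFn_smul Complex.I (m1.toLp _), m1.coeFn_toLp, m2.coeFn_toLp] with x k1 k2 k3 k4
    rw [k1, Pi.sub_apply, k2, Pi.smul_apply, k3, k4]
    simp only [w, map_sub, map_mul, map_neg, Complex.conj_I, Complex.conj_ofReal, smul_eq_mul,
      Complex.real_smul]
    push_cast
    ring
  simp only at h0
  have hint := (integrable_conj_mul (m2.toLp w - Complex.I • m1.toLp _ : L2 n) g).congr hpt
  rw [L2_inner_eq, integral_congr_ae hpt, integral_fibre hint] at h0
  simp only [integral_const_mul, integral_smul] at h0
  have h1 := (mul_eq_zero.1 h0).resolve_left Complex.I_ne_zero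
  rw [← h1]
  refine integral_congr_ae ?_
  filter_upwards [hsplit] with y hy
  rw [hy]

theorem dense_range_shear {ψ : EuclideanSpace ℝ (Fin n) → ℝ} (hψ : Continuous ψ)
    (hpos : ∀ y, 0 < ψ y) :
    Dense ((fun p : L2 n × L2 n => p.2 - Complex.I • p.1) ''
      (testGraph ψ : Set (L2 n × L2 n))) := by
  let T : L2 n × L2 n →ₗ[ℂ] L2 n := LinearMap.snd ℂ _ _ - Complex.I • LinearMap.fst ℂ _ _
  change Dense (((testGraph ψ).map T : Submodule ℂ (L2 n)) : Set (L2 n))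
  rw [Submodule.dense_iff_topologicalClosure_eq_top, Submodule.topologicalClosure_eq_top_iff,
    Submodule.eq_bot_iff]
  intro g hg
  have hg' : ∀ p ∈ testGraph ψ, inner ℂ (p.2 - Complex.I • p.1) g = 0 :=
    fun p hp => hg _ ⟨p, hp, rfl⟩
  -- Only countably many test functions are used, so a single null set of `y` serves for all of
  -- them.
  have key : ∀ᵐ y : EuclideanSpace ℝ (Fin n), ∀ (j : ℕ) (q : ℚ),
      ∫ t : ℝ, (lineMollifier j (q - t) - ψ y * deriv (lineMollifier j) (q - t)) • g (t, y) = 0 := by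
    rw [ae_all_iff]
    intro j
    rw [ae_all_iff]
    intro q
    have h1 : ContDiff ℝ ∞ fun t => lineMollifier j (q - t) :=
      (contDiff_lineMollifier j).comp (by fun_prop)
    have h2 : HasCompactSupport fun t => lineMollifier j (q - t) :=
      (hasCompactSupport_lineMollifier j).comp_homeomorph (Homeomorph.subLeft (q : ℝ))
    filter_upwards [ae_integral_fibre_eq_zero hψ hg' h1 h2] with y hy
    rw [← hy]
    congr 1
    ext t
    rw [deriv_comp_const_sub, mul_neg, sub_eq_add_neg]
  have hfib : ∀ᵐ y : EuclideanSpace ℝ (Fin n), ∀ᵐ t : ℝ, g (t, y) = 0 := by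
    filter_upwards [key, memLp_fibre (Lp.memLp g)] with y h1 h2
    exact ae_eq_zero_of_weak_ode h2 (hpos y) h1
  have hfin : ∫⁻ x, ‖g x‖ₑ ^ 2 = 0 := by
    have hm : AEMeasurable (fun x => ‖g x‖ₑ ^ 2) (volume : Measure (Space n)) :=
      (Lp.aestronglyMeasurable g).enorm.pow_const 2
    rw [lintegral_fibre hm, lintegral_eq_zero_iff' (AEMeasurable.lintegral_prod_left' hm)]
    filter_upwards [hfib] with y hy
    rw [Pi.zero_apply, lintegral_eq_zero_of_ae_eq_zero]
    filter_upwards [hy] with t ht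
    simp [ht]
  rw [← norm_eq_zero, Lp.norm_def, ENNReal.toReal_eq_zero_iff]
  left
  rw [← eLpNorm_two_sq] at hfin
  exact pow_eq_zero_iff two_ne_zero |>.1 hfin

theorem diagonalizes_shearFlow {ψ : EuclideanSpace ℝ (Fin n) → ℝ} (hψ : Continuous ψ)
    (hpos : ∀ y, 0 < ψ y) : Diagonalizes (fourierUnitary n) (shearSymbol ψ) (shearFlow ψ) := by
  refine diagonalizes_closure (measurable_shearSymbol hψ) ?_ ?_
  · rw [shearTest_graph]
    exact fun p hp => testGraph_ae_eq ψ hp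
  · rw [shearTest_graph]
    exact dense_range_shear hψ hpos

end Density
end ShearFlow
end

noncomputable section

namespace ShearFlow

/-! ### Weighted spaces -/

section Weight

variable {n : ℕ}

/-- The weight `(1 + t²)^σ`. -/
def weight (σ t : ℝ) : ℝ := (1 + t ^ 2) ^ σ

theorem weight_pos (σ t : ℝ) : 0 < weight σ t := by
  unfold weight
  positivity

theorem measurable_weight (σ : ℝ) : Measurable (weight σ) := by
  unfold weight
  fun_prop

theorem weight_add (σ τ t : ℝ) : weight (σ + τ) t = weight σ t * weight τ t :=
  Real.rpow_add (by positivity) _ _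

theorem weight_zero (t : ℝ) : weight 0 t = 1 := Real.rpow_zero _

theorem weight_half_sq (σ t : ℝ) : weight (σ / 2) t ^ 2 = weight σ t := by
  rw [pow_two, ← weight_add, add_halves]

theorem measurable_ofReal_weight (σ : ℝ) :
    Measurable fun x : Space n => ENNReal.ofReal (weight σ x.1) :=
  ((measurable_weight σ).comp measurable_fst).ennreal_ofReal

theorem weightMeasure_eq (σ : ℝ) :
    weightMeasure n σ = volume.withDensity fun x => ENNReal.ofReal (weight σ x.1) := rfl

/-- The density is strictly positive, so weighted and Lebesgue null sets agree. -/
theorem ae_weightMeasure (σ : ℝ) : ae (weightMeasure n σ) = ae (volume : Measure (Space n)) := by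
  refine le_antisymm (withDensity_absolutelyContinuous _ _).ae_le
    (withDensity_absolutelyContinuous' (measurable_ofReal_weight σ).aemeasurable ?_).ae_le
  refine Filter.Eventually.of_forall fun x => ?_
  simpa using! weight_pos σ x.1

theorem ae_eq_weightMeasure (σ : ℝ) {E : Type*} {f g : Space n → E} :
    f =ᵐ[weightMeasure n σ] g ↔ f =ᵐ[volume] g := by
  rw [Filter.EventuallyEq, Filter.EventuallyEq, ae_weightMeasure]

theorem lintegral_weightMeasure (σ : ℝ) {f : Space n → ℝ≥0∞} (hf : AEMeasurable f) :
    ∫⁻ x, f x ∂weightMeasure n σ = ∫⁻ x, ENNReal.ofReal (weight σ x.1) * f x :=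
  lintegral_withDensity_eq_lintegral_mul₀ (measurable_ofReal_weight σ).aemeasurable hf

theorem integral_weightMeasure (σ : ℝ) {E : Type*} [NormedAddCommGroup E] [NormedSpace ℝ E]
    (f : Space n → E) : ∫ x, f x ∂weightMeasure n σ = ∫ x, weight σ x.1 • f x := by
  rw [weightMeasure_eq, integral_withDensity_eq_integral_toReal_smul (measurable_ofReal_weight σ)
    (Filter.Eventually.of_forall fun x => ENNReal.ofReal_lt_top)]
  refine integral_congr_ae (Filter.Eventually.of_forall fun x => ?_)
  simp only
  rw [ENNReal.toReal_ofReal (weight_pos σ x.1).le]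

theorem integrable_weightMeasure (σ : ℝ) {E : Type*} [NormedAddCommGroup E] [NormedSpace ℝ E]
    {f : Space n → E} :
    Integrable f (weightMeasure n σ) ↔ Integrable (fun x => weight σ x.1 • f x) := by
  rw [weightMeasure_eq, integrable_withDensity_iff_integrable_smul' (measurable_ofReal_weight σ)
    (Filter.Eventually.of_forall fun x => ENNReal.ofReal_lt_top)]
  refine integrable_congr (Filter.Eventually.of_forall fun x => ?_)
  simp only
  rw [ENNReal.toReal_ofReal (weight_pos σ x.1).le]

theorem eLpNorm_weight_mul (σ τ : ℝ) {f : Space n → ℂ} (hf : StronglyMeasurable f) :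
    eLpNorm (fun x => (weight ((σ - τ) / 2) x.1 : ℂ) * f x) 2 (weightMeasure n τ)
      = eLpNorm f 2 (weightMeasure n σ) := by
  refine (ENNReal.pow_right_strictMono two_ne_zero).injective ?_
  have hw : Measurable fun x : Space n => (weight ((σ - τ) / 2) x.1 : ℂ) :=
    Complex.measurable_ofReal.comp ((measurable_weight _).comp measurable_fst)
  have m1 : Measurable (fun x => ‖f x‖ₑ ^ 2) := hf.enorm.pow_const 2
  have m2 : Measurable (fun x : Space n => ‖(weight ((σ - τ) / 2) x.1 : ℂ) * f x‖ₑ ^ 2) :=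
    (hw.mul hf.measurable).enorm.pow_const 2
  rw [eLpNorm_two_sq, eLpNorm_two_sq, lintegral_weightMeasure _ m1.aemeasurable,
    lintegral_weightMeasure _ m2.aemeasurable]
  refine lintegral_congr fun x => ?_
  rw [enorm_mul, mul_pow, ← mul_assoc]
  congr 1
  rw [← ofReal_norm, Complex.norm_real, Real.norm_of_nonneg (weight_pos _ _).le,
    ← ENNReal.ofReal_pow (weight_pos _ _).le, ← ENNReal.ofReal_mul (weight_pos _ _).le,
    weight_half_sq, ← weight_add, add_sub_cancel]

theorem memLp_weight_mul (σ τ : ℝ) (u : X n σ) :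
    MemLp (fun x => (weight ((σ - τ) / 2) x.1 : ℂ) * u x) 2 (weightMeasure n τ) := by
  have hw : Measurable fun x : Space n => (weight ((σ - τ) / 2) x.1 : ℂ) :=
    Complex.measurable_ofReal.comp ((measurable_weight _).comp measurable_fst)
  refine ⟨(hw.mul (Lp.stronglyMeasurable u).measurable).aestronglyMeasurable, ?_⟩
  rw [eLpNorm_weight_mul σ τ (Lp.stronglyMeasurable u)]
  exact (Lp.memLp u).2

variable (n) in
/-- The isometry `u ↦ (1 + x₁²)^((σ - τ) / 2) u` from `𝓧^σ` to `𝓧^τ`. -/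
def weightShift (σ τ : ℝ) : X n σ →ₗᵢ[ℂ] X n τ where
  toFun u := (memLp_weight_mul σ τ u).toLp _
  map_add' u v := by
    rw [← MemLp.toLp_add]
    refine MemLp.toLp_congr _ _ ((ae_eq_weightMeasure τ).2 ?_)
    filter_upwards [(ae_eq_weightMeasure σ).1 (Lp.coeFn_add u v)] with x hx
    simp only [hx, Pi.add_apply, mul_add]
  map_smul' c u := by
    rw [RingHom.id_apply, ← MemLp.toLp_const_smul]
    refine MemLp.toLp_congr _ _ ((ae_eq_weightMeasure τ).2 ?_)
    filter_upwards [(ae_eq_weightMeasure σ).1 (Lp.coeFn_smul c u)] with x hx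
    simp only [hx, Pi.smul_apply, smul_eq_mul]
    ring
  norm_map' u := by
    simp only [LinearMap.coe_mk, AddHom.coe_mk]
    rw [Lp.norm_toLp, eLpNorm_weight_mul σ τ (Lp.stronglyMeasurable u), Lp.norm_def]

theorem weightShift_ae_eq (σ τ : ℝ) (u : X n σ) :
    weightShift n σ τ u =ᵐ[volume] fun x => (weight ((σ - τ) / 2) x.1 : ℂ) * u x :=
  (ae_eq_weightMeasure τ).1 (MemLp.coeFn_toLp (memLp_weight_mul σ τ u))

theorem weightShift_weightShift (σ τ : ℝ) (u : X n τ) :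
    weightShift n σ τ (weightShift n τ σ u) = u := by
  refine Lp.ext ((ae_eq_weightMeasure τ).2 ?_)
  filter_upwards [weightShift_ae_eq σ τ (weightShift n τ σ u), weightShift_ae_eq τ σ u] with x h1 h2
  rw [h1, h2, ← mul_assoc, ← Complex.ofReal_mul, ← weight_add,
    show (σ - τ) / 2 + (τ - σ) / 2 = 0 by ring, weight_zero, Complex.ofReal_one, one_mul]

variable (n) in
/-- The unitary operator `u ↦ (1 + x₁²)^((σ - τ) / 2) u` from `𝓧^σ` to `𝓧^τ`. -/
def weightEquiv (σ τ : ℝ) : X n σ ≃ₗᵢ[ℂ] X n τ :=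
  LinearIsometryEquiv.ofSurjective (weightShift n σ τ)
    fun u => ⟨_, weightShift_weightShift σ τ u⟩

/-! ### Duality of the weighted spaces -/

/-- The shift from `-σ` to `σ` multiplies by `(1 + x₁²)^(-σ)`, which cancels the density of the
measure of `𝓧^σ` and leaves the unweighted pairing. -/
theorem inner_weightEquiv (σ : ℝ) (u : X n (-σ)) (v : X n σ) :
    inner ℂ v (weightEquiv n (-σ) σ u) = pairing u v := by
  have h : inner ℂ v (weightEquiv n (-σ) σ u)
      = ∫ x, conj (v x) * (weightEquiv n (-σ) σ u) x ∂weightMeasure n σ := Lp_inner_eq _ _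
  rw [h, integral_weightMeasure, pairing]
  refine integral_congr_ae ?_
  filter_upwards [weightShift_ae_eq (-σ) σ u] with x hx
  have hx' : weightEquiv n (-σ) σ u x = (weight ((-σ - σ) / 2) x.1 : ℂ) * u x := hx
  rw [hx', Complex.real_smul, show (-σ - σ) / 2 = -σ by ring]
  have : (weight σ x.1 : ℂ) * (weight (-σ) x.1 : ℂ) = 1 := by
    rw [← Complex.ofReal_mul, ← weight_add, add_neg_cancel, weight_zero, Complex.ofReal_one]
  linear_combination (conj (v x) * u x) * this

/-- The Riesz isometry of a complex Hilbert space onto its space of bounded antilinear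
functionals. -/
def antidualEquiv (𝓗 : Type*) [NormedAddCommGroup 𝓗] [InnerProductSpace ℂ 𝓗] [CompleteSpace 𝓗] :
    𝓗 ≃ₗᵢ[ℂ] (𝓗 →L⋆[ℂ] ℂ) :=
  LinearIsometryEquiv.ofSurjective
    { toLinearMap := (innerSLFlip ℂ : 𝓗 →L[ℂ] 𝓗 →L⋆[ℂ] ℂ)
      norm_map' := fun x => by
        refine le_antisymm (ContinuousLinearMap.opNorm_le_bound _ (norm_nonneg x) fun y => ?_) ?_
        · simp only [ContinuousLinearMap.coe_coe, innerSLFlip_apply_apply]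
          rw [mul_comm]
          exact norm_inner_le_norm y x
        · rcases (norm_nonneg x).eq_or_lt with h | h
          · rw [← h]
            exact norm_nonneg _
          · have h1 := ContinuousLinearMap.le_opNorm (innerSLFlip ℂ x) x
            rw [innerSLFlip_apply_apply, inner_self_eq_norm_sq_to_K, norm_pow, RCLike.norm_ofReal,
              abs_norm, pow_two] at h1
            exact le_of_mul_le_mul_right h1 h }
    fun φ => by
      let φ' : StrongDual ℂ 𝓗 :=
        { toFun := fun v => conj (φ v)
          map_add' := fun v w => by simp
          map_smul' := fun c v => by simp
          cont := by fun_prop }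
      refine ⟨(InnerProductSpace.toDual ℂ 𝓗).symm φ', ?_⟩
      ext v
      change inner ℂ v _ = φ v
      rw [← inner_conj_symm, InnerProductSpace.toDual_symm_apply]
      exact Complex.conj_conj _

variable (n) in
/-- The isometry of `𝓧^(-σ)` onto the antidual of `𝓧^σ` given by the pairing. -/
def dualityEquiv (σ : ℝ) : X n (-σ) ≃ₗᵢ[ℂ] (X n σ →L⋆[ℂ] ℂ) :=
  (weightEquiv n (-σ) σ).trans (antidualEquiv (X n σ))

theorem dualityEquiv_apply (σ : ℝ) (u : X n (-σ)) (v : X n σ) :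
    dualityEquiv n σ u v = pairing u v :=
  inner_weightEquiv σ u v

end Weight
end ShearFlow
end

noncomputable section

namespace ShearFlow

open scoped FourierTransform

/-! ### The Fourier transform on weighted spaces -/

section WeightedFourier

variable {n : ℕ}

theorem integral_mul_le_sqrt {α : Type*} [MeasurableSpace α] {μ : Measure α} {f g : α → ℝ}
    (hf0 : ∀ x, 0 ≤ f x) (hg0 : ∀ x, 0 ≤ g x) (hf : MemLp f 2 μ) (hg : MemLp g 2 μ) :
    ∫ x, f x * g x ∂μ ≤ √(∫ x, f x ^ 2 ∂μ) * √(∫ x, g x ^ 2 ∂μ) := by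
  have h := integral_mul_le_Lp_mul_Lq_of_nonneg Real.HolderConjugate.two_two (μ := μ)
    (Filter.Eventually.of_forall hf0) (Filter.Eventually.of_forall hg0)
    (by simpa using hf) (by simpa using hg)
  simpa only [Real.rpow_two, ← Real.sqrt_eq_rpow] using h

/-- The integral of `(1 + t²)^(-σ)`. -/
def weightConst (σ : ℝ) : ℝ := ∫ t : ℝ, weight (-σ) t

theorem integrable_weight_neg {σ : ℝ} (hσ : 1 / 2 < σ) : Integrable (weight (-σ)) := by
  have h := integrable_rpow_neg_one_add_norm_sq (E := ℝ) (μ := volume) (r := 2 * σ)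
    (by simp only [Module.finrank_self, Nat.cast_one]; linarith)
  refine h.congr (Filter.Eventually.of_forall fun t => ?_)
  simp only [weight, Real.norm_eq_abs, sq_abs]
  congr 1
  ring

theorem weightConst_nonneg (σ : ℝ) : 0 ≤ weightConst σ :=
  integral_nonneg fun t => (weight_pos _ t).le

/-- Cauchy–Schwarz for `|h| = w^(-1/2) · w^(1/2) |h|` with `w = (1 + t²)^σ`; `1/w` is integrable
because `2σ > 1`. -/
theorem integrable_and_integral_norm_le {σ : ℝ} (hσ : 1 / 2 < σ) {h : ℝ → ℂ}
    (hm : AEStronglyMeasurable h) (hi : Integrable fun t => weight σ t * ‖h t‖ ^ 2) :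
    Integrable h ∧
      ∫ t, ‖h t‖ ≤ √(weightConst σ) * √(∫ t, weight σ t * ‖h t‖ ^ 2) := by
  have sq1 : ∀ t, weight (-σ / 2) t ^ 2 = weight (-σ) t := weight_half_sq (-σ)
  have sq2 : ∀ t, (weight (σ / 2) t * ‖h t‖) ^ 2 = weight σ t * ‖h t‖ ^ 2 := fun t => by
    rw [mul_pow, weight_half_sq]
  have m1 : MemLp (fun t => weight (-σ / 2) t) 2 := by
    rw [memLp_two_iff_integrable_sq (measurable_weight _).aestronglyMeasurable]
    simpa only [sq1] using integrable_weight_neg hσ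
  have m2 : MemLp (fun t => weight (σ / 2) t * ‖h t‖) 2 := by
    have hm' : AEStronglyMeasurable (fun t => weight (σ / 2) t * ‖h t‖) :=
      (measurable_weight _).aestronglyMeasurable.mul hm.norm
    rw [memLp_two_iff_integrable_sq hm']
    simpa only [sq2] using hi
  have e : ∀ t, weight (-σ / 2) t * (weight (σ / 2) t * ‖h t‖) = ‖h t‖ := fun t => by
    rw [← mul_assoc, ← weight_add, show -σ / 2 + σ / 2 = 0 by ring, weight_zero, one_mul]
  have hint : Integrable fun t => ‖h t‖ := by
    have := m1.integrable_mul m2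
    exact this.congr (Filter.Eventually.of_forall e)
  refine ⟨(integrable_norm_iff hm).1 hint, ?_⟩
  have := integral_mul_le_sqrt (fun t => (weight_pos (-σ / 2) t).le)
    (fun t => mul_nonneg (weight_pos (σ / 2) t).le (norm_nonneg (h t))) m1 m2
  simpa only [e, sq1, sq2] using! this

theorem toL2_ae_eq {σ : ℝ} (hσ : 0 ≤ σ) (f : X n σ) : X.toL2 hσ f =ᵐ[volume] f :=
  MemLp.coeFn_toLp ((Lp.memLp f).mono_measure (volume_le_weightMeasure n hσ))

theorem toL2_add {σ : ℝ} (hσ : 0 ≤ σ) (f g : X n σ) :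
    X.toL2 hσ (f + g) = X.toL2 hσ f + X.toL2 hσ g := by
  refine Lp.ext ?_
  filter_upwards [toL2_ae_eq hσ (f + g), toL2_ae_eq hσ f, toL2_ae_eq hσ g,
    Lp.coeFn_add (X.toL2 hσ f) (X.toL2 hσ g), (ae_eq_weightMeasure σ).1 (Lp.coeFn_add f g)]
    with x h1 h2 h3 h4 h5
  rw [h1, h5, h4, Pi.add_apply, Pi.add_apply, h2, h3]

theorem toL2_smul {σ : ℝ} (hσ : 0 ≤ σ) (c : ℂ) (f : X n σ) :
    X.toL2 hσ (c • f) = c • X.toL2 hσ f := by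
  refine Lp.ext ?_
  filter_upwards [toL2_ae_eq hσ (c • f), toL2_ae_eq hσ f, Lp.coeFn_smul c (X.toL2 hσ f),
    (ae_eq_weightMeasure σ).1 (Lp.coeFn_smul c f)] with x h1 h2 h3 h4
  rw [h1, h4, h3, Pi.smul_apply, Pi.smul_apply, h2]

theorem integrable_weight_toL2 {σ : ℝ} (hσ : 0 ≤ σ) (f : X n σ) :
    Integrable (fun x : Space n => weight σ x.1 * ‖X.toL2 hσ f x‖ ^ 2) ∧
      ∫ x : Space n, weight σ x.1 * ‖X.toL2 hσ f x‖ ^ 2 = ‖f‖ ^ 2 := by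
  have hae : (fun x : Space n => weight σ x.1 * ‖X.toL2 hσ f x‖ ^ 2)
      =ᵐ[volume] fun x => weight σ x.1 • ‖f x‖ ^ 2 := by
    filter_upwards [toL2_ae_eq hσ f] with x hx
    rw [hx, smul_eq_mul]
  have hi : Integrable (fun x => ‖f x‖ ^ 2) (weightMeasure n σ) :=
    (Lp.memLp f).integrable_norm_pow (by norm_num)
  refine ⟨((integrable_weightMeasure σ).1 hi).congr hae.symm, ?_⟩
  rw [integral_congr_ae hae, ← integral_weightMeasure]
  have h1 : inner ℂ f f = ∫ x, inner ℂ (f x) (f x) ∂weightMeasure n σ := L2.inner_def f f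
  rw [inner_self_eq_norm_sq_to_K] at h1
  simp only [inner_self_eq_norm_sq_to_K] at h1
  have h2 : ∫ x, ((‖f x‖ : ℂ)) ^ 2 ∂weightMeasure n σ
      = ((∫ x, ‖f x‖ ^ 2 ∂weightMeasure n σ : ℝ) : ℂ) := by
    rw [← integral_complex_ofReal]
    simp only [Complex.ofReal_pow]
  have h3 : ((‖f‖ ^ 2 : ℝ) : ℂ) = ((∫ x, ‖f x‖ ^ 2 ∂weightMeasure n σ : ℝ) : ℂ) := by
    rw [← h2, Complex.ofReal_pow]
    exact h1
  exact (Complex.ofReal_injective h3).symm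

/-- The weighted norm of a fibre. -/
def fibreNorm (σ : ℝ) (f : Space n → ℂ) (y : EuclideanSpace ℝ (Fin n)) : ℝ :=
  √(∫ t : ℝ, weight σ t * ‖f (t, y)‖ ^ 2)

theorem fibreNorm_sq (σ : ℝ) (f : Space n → ℂ) (y : EuclideanSpace ℝ (Fin n)) :
    fibreNorm σ f y ^ 2 = ∫ t : ℝ, weight σ t * ‖f (t, y)‖ ^ 2 :=
  Real.sq_sqrt (integral_nonneg fun t => mul_nonneg (weight_pos σ t).le (sq_nonneg _))

theorem memLp_fibreNorm {σ : ℝ} (hσ : 0 ≤ σ) (f : X n σ) :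
    MemLp (fibreNorm σ (X.toL2 hσ f)) 2 ∧
      ∫ y, fibreNorm σ (X.toL2 hσ f) y ^ 2 = ‖f‖ ^ 2 := by
  obtain ⟨h1, h2⟩ := integrable_weight_toL2 hσ f
  have h3 := h1.integral_prod_right
  constructor
  · have hm : AEStronglyMeasurable (fibreNorm σ (X.toL2 hσ f)) :=
      Real.continuous_sqrt.comp_aestronglyMeasurable h3.aestronglyMeasurable
    rw [memLp_two_iff_integrable_sq hm]
    simpa only [fibreNorm_sq] using! h3
  · simp only [fibreNorm_sq]
    rw [← h2]
    exact (integral_prod_symm _ h1).symm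

theorem fibre_toL2 {σ : ℝ} (hσ : 1 / 2 < σ) (hσ0 : 0 ≤ σ) (f : X n σ) :
    ∀ᵐ y : EuclideanSpace ℝ (Fin n), Integrable (fun t : ℝ => X.toL2 hσ0 f (t, y)) ∧
      ∫ t : ℝ, ‖X.toL2 hσ0 f (t, y)‖ ≤ √(weightConst σ) * fibreNorm σ (X.toL2 hσ0 f) y := by
  filter_upwards [memLp_fibre (Lp.memLp (X.toL2 hσ0 f)),
    (integrable_weight_toL2 hσ0 f).1.prod_left_ae] with y h1 h2
  exact integrable_and_integral_norm_le hσ h1.1 h2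

theorem toL2_mem_fibreIntegrable {σ : ℝ} (hσ : 1 / 2 < σ) (hσ0 : 0 ≤ σ) (f : X n σ) :
    X.toL2 hσ0 f ∈ fibreIntegrable n := by
  rw [mem_fibreIntegrable]
  filter_upwards [fibre_toL2 hσ hσ0 f] with y hy using hy.1

/-- Evaluation of the transform at one frequency is thereby meaningful on almost every fibre, with a
bound independent of `k` and square integrable in `y`. -/
theorem fibreFourier_toL2 {σ : ℝ} (hσ : 1 / 2 < σ) (hσ0 : 0 ≤ σ) (f : X n σ) :
    ∀ᵐ y : EuclideanSpace ℝ (Fin n),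
      (Continuous fun k : ℝ => fibreFourier (X.toL2 hσ0 f) (k, y)) ∧
      ∀ k : ℝ, ‖fibreFourier (X.toL2 hσ0 f) (k, y)‖
        ≤ √(weightConst σ) * fibreNorm σ (X.toL2 hσ0 f) y := by
  filter_upwards [fibre_toL2 hσ hσ0 f] with y hy
  refine ⟨continuous_fourier hy.1, fun k => ?_⟩
  exact (norm_fourier_le _ k).trans hy.2

end WeightedFourier

/-! ### Differentiability of the spectral family -/

section SpectralDerivative

variable {n : ℕ}

theorem hasDerivAt_integral_Iic {h : ℝ → ℂ} (hc : Continuous h) (hi : Integrable h) (b : ℝ) :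
    HasDerivAt (fun b => ∫ k in Set.Iic b, h k) (h b) b := by
  have e : (fun b => ∫ k in Set.Iic b, h k)
      = fun b => (∫ k in (0 : ℝ)..b, h k) + ∫ k in Set.Iic 0, h k := by
    funext b
    rw [← intervalIntegral.integral_Iic_sub_Iic hi.integrableOn hi.integrableOn, sub_add_cancel]
  rw [e]
  exact (intervalIntegral.integral_hasDerivAt_right (hc.intervalIntegrable _ _)
    (hc.stronglyMeasurableAtFilter _ _) hc.continuousAt).add_const _

/-- The product `û conj(v̂)` of the partial Fourier transforms. -/
def fourierProduct (u v : Space n → ℂ) (x : Space n) : ℂ :=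
  conj (fibreFourier v x) * fibreFourier u x

variable {σ : ℝ} {ψ : EuclideanSpace ℝ (Fin n) → ℝ}

theorem integrable_fourierProduct {u v : L2 n} (hu : u ∈ fibreIntegrable n)
    (hv : v ∈ fibreIntegrable n) : Integrable (fourierProduct (u : Space n → ℂ) v) := by
  refine (integrable_conj_mul (fourierUnitary n v) (fourierUnitary n u)).congr ?_
  filter_upwards [fourierUnitary_ae_eq hu, fourierUnitary_ae_eq hv] with x h1 h2
  rw [h1, h2, fourierProduct]

theorem integral_belowSymbol_fibre {y : EuclideanSpace ℝ (Fin n)} (hy : 0 < ψ y) (μ : ℝ)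
    (h : ℝ → ℂ) : ∫ k, belowSymbol (shearSymbol ψ) μ (k, y) * h k
      = ∫ k in Set.Iic (μ / (2 * Real.pi * ψ y)), h k := by
  rw [← integral_indicator measurableSet_Iic]
  congr 1
  funext k
  have hp : 0 < 2 * Real.pi * ψ y := by positivity
  have hiff : shearSymbol ψ (k, y) ≤ μ ↔ k ≤ μ / (2 * Real.pi * ψ y) := by
    rw [le_div_iff₀ hp, shearSymbol]
    ring_nf
  by_cases hk : k ≤ μ / (2 * Real.pi * ψ y)
  · simp [belowSymbol, Set.indicator, hiff.2 hk, hk]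
  · have h' : ¬ shearSymbol ψ (k, y) ≤ μ := fun h' => hk (hiff.1 h')
    simp [belowSymbol, Set.indicator, h', hk]

/-- Over a fixed `y` the set `{2πkψ(y) ≤ μ}` is a half-line, since `ψ(y) > 0`; all dependence on `μ`
moves to its endpoint. -/
theorem inner_spectralProj (hψ : Continuous ψ) (hpos : ∀ y, 0 < ψ y) {u v : L2 n}
    (hu : u ∈ fibreIntegrable n) (hv : v ∈ fibreIntegrable n) (μ : ℝ) :
    Integrable (fun x : Space n => belowSymbol (shearSymbol ψ) μ x * fourierProduct u v x) ∧
    inner ℂ v (spectralProj (fourierUnitary n) (measurable_shearSymbol hψ) μ u)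
      = ∫ y, ∫ k in Set.Iic (μ / (2 * Real.pi * ψ y)), fourierProduct u v (k, y) := by
  have hae : (fun x => conj (fourierUnitary n v x) *
      fourierUnitary n (spectralProj (fourierUnitary n) (measurable_shearSymbol hψ) μ u) x)
      =ᵐ[volume] fun x => belowSymbol (shearSymbol ψ) μ x * fourierProduct u v x := by
    filter_upwards [fourierUnitary_ae_eq hu, fourierUnitary_ae_eq hv,
      spectralProj_ae_eq (measurable_shearSymbol hψ) μ u (U := fourierUnitary n)] with x h1 h2 h3
    rw [h3, h1, h2, fourierProduct]
    ring
  have hi := (integrable_conj_mul _ _).congr hae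
  refine ⟨hi, ?_⟩
  rw [← (fourierUnitary n).inner_map_map, L2_inner_eq, integral_congr_ae hae, integral_fibre hi]
  congr 1
  funext y
  exact integral_belowSymbol_fibre (hpos y) μ fun k => fourierProduct u v (k, y)

theorem exists_hasDerivAt_inner_spectralProj (hσ : 1 / 2 < σ) (hσ0 : 0 ≤ σ) (hψ : Continuous ψ)
    {ℓ : ℝ} (hℓ : 0 < ℓ) (hlow : ∀ y, ℓ < ψ y) (lam : ℝ) (f g : X n σ) :
    ∃ a : ℂ, HasDerivAt (fun μ : ℝ => inner ℂ (X.toL2 hσ0 g)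
        (spectralProj (fourierUnitary n) (measurable_shearSymbol hψ) μ (X.toL2 hσ0 f))) a lam ∧
      ‖a‖ ≤ weightConst σ / (2 * Real.pi * ℓ) * ‖f‖ * ‖g‖ := by
  have hpos : ∀ y, 0 < ψ y := fun y => hℓ.trans (hlow y)
  set u := X.toL2 hσ0 f with hu_def
  set v := X.toL2 hσ0 g with hv_def
  have hu : u ∈ fibreIntegrable n := toL2_mem_fibreIntegrable hσ hσ0 f
  have hv : v ∈ fibreIntegrable n := toL2_mem_fibreIntegrable hσ hσ0 g
  have hin := inner_spectralProj hψ hpos hu hv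
  let F : ℝ → EuclideanSpace ℝ (Fin n) → ℂ := fun μ y =>
    ∫ k in Set.Iic (μ / (2 * Real.pi * ψ y)), fourierProduct u v (k, y)
  -- Chain rule: the integrand at the endpoint times the speed `1 / (2πψ(y))` of the endpoint.
  let F' : ℝ → EuclideanSpace ℝ (Fin n) → ℂ := fun μ y =>
    (1 / (2 * Real.pi * ψ y)) • fourierProduct u v (μ / (2 * Real.pi * ψ y), y)
  let bound : EuclideanSpace ℝ (Fin n) → ℝ := fun y =>
    weightConst σ / (2 * Real.pi * ℓ) * (fibreNorm σ u y * fibreNorm σ v y)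
  have hFint : ∀ μ, Integrable (F μ) := by
    intro μ
    refine (hin μ).1.integral_prod_right.congr (Filter.Eventually.of_forall fun y => ?_)
    exact integral_belowSymbol_fibre (hpos y) μ fun k => fourierProduct u v (k, y)
  have hF'm : AEStronglyMeasurable (F' lam) volume := by
    have mp : StronglyMeasurable (fourierProduct u v) := by
      unfold fourierProduct
      exact (Complex.continuous_conj.comp_stronglyMeasurable
        (stronglyMeasurable_fibreFourier (Lp.stronglyMeasurable v))).mul
        (stronglyMeasurable_fibreFourier (Lp.stronglyMeasurable u))
    have mψ := hψ.measurable
    have m1 : Measurable fun y : EuclideanSpace ℝ (Fin n) =>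
        ((lam / (2 * Real.pi * ψ y), y) : Space n) := by fun_prop
    have m2 : Measurable fun y : EuclideanSpace ℝ (Fin n) => 1 / (2 * Real.pi * ψ y) := by fun_prop
    exact (m2.stronglyMeasurable.smul (mp.comp_measurable m1)).aestronglyMeasurable
  obtain ⟨nu, nu'⟩ := memLp_fibreNorm hσ0 f
  obtain ⟨nv, nv'⟩ := memLp_fibreNorm hσ0 g
  rw [← hu_def] at nu nu'
  rw [← hv_def] at nv nv'
  have hbint : Integrable bound := (nu.integrable_mul nv).const_mul _
  have hc := weightConst_nonneg σ
  have hb : ∀ᵐ y : EuclideanSpace ℝ (Fin n), ∀ μ, ‖F' μ y‖ ≤ bound y := by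
    filter_upwards [fibreFourier_toL2 hσ hσ0 f, fibreFourier_toL2 hσ hσ0 g] with y h1 h2 μ
    have k1 := h1.2 (μ / (2 * Real.pi * ψ y))
    have k2 := h2.2 (μ / (2 * Real.pi * ψ y))
    rw [← hu_def] at k1
    rw [← hv_def] at k2
    have hp : 0 < 2 * Real.pi * ψ y := mul_pos (by positivity) (hpos y)
    simp only [F', bound, fourierProduct]
    rw [norm_smul, norm_mul, RCLike.norm_conj, Real.norm_of_nonneg (by positivity)]
    have k3 : 1 / (2 * Real.pi * ψ y) ≤ 1 / (2 * Real.pi * ℓ) := by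
      have := (hlow y).le
      gcongr
    calc _ ≤ 1 / (2 * Real.pi * ℓ) * ((√(weightConst σ) * fibreNorm σ v y) *
          (√(weightConst σ) * fibreNorm σ u y)) := by
          refine mul_le_mul k3 (mul_le_mul k2 k1 (norm_nonneg _) ((norm_nonneg _).trans k2))
            (by positivity) (by positivity)
      _ = 1 / (2 * Real.pi * ℓ) * (√(weightConst σ) * √(weightConst σ)) *
          (fibreNorm σ u y * fibreNorm σ v y) := by ring
      _ = _ := by rw [Real.mul_self_sqrt hc]; ring
  have hdiff : ∀ᵐ y : EuclideanSpace ℝ (Fin n), ∀ μ, HasDerivAt (fun μ => F μ y) (F' μ y) μ := by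
    filter_upwards [fibreFourier_toL2 hσ hσ0 f, fibreFourier_toL2 hσ hσ0 g,
      (integrable_fourierProduct hu hv).prod_left_ae] with y h1 h2 h3 μ
    have hcont : Continuous fun k : ℝ => fourierProduct u v (k, y) :=
      (Complex.continuous_conj.comp h2.1).mul h1.1
    have k1 := hasDerivAt_integral_Iic hcont h3 (μ / (2 * Real.pi * ψ y))
    have k2 : HasDerivAt (fun μ : ℝ => μ / (2 * Real.pi * ψ y)) (1 / (2 * Real.pi * ψ y)) μ :=
      (hasDerivAt_id μ).div_const _
    exact k1.scomp μ k2
  -- The dominating function does not depend on `μ`, so the neighbourhood can be the whole line.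
  have key := hasDerivAt_integral_of_dominated_loc_of_deriv_le (μ := volume) (x₀ := lam)
    (F := F) (F' := F') (bound := bound) (s := Set.univ) Filter.univ_mem
    (Filter.Eventually.of_forall fun μ => (hFint μ).aestronglyMeasurable) (hFint lam) hF'm
    (hb.mono fun y hy μ _ => hy μ) hbint (hdiff.mono fun y hy μ _ => hy μ)
  refine ⟨∫ y, F' lam y, ?_, ?_⟩
  · have e : (fun μ : ℝ => inner ℂ v
        (spectralProj (fourierUnitary n) (measurable_shearSymbol hψ) μ u))
        = fun μ => ∫ y, F μ y := funext fun μ => (hin μ).2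
    rw [e]
    exact key.2
  · refine (norm_integral_le_of_norm_le hbint (hb.mono fun y hy => hy lam)).trans ?_
    simp only [bound]
    rw [integral_const_mul, mul_assoc (weightConst σ / (2 * Real.pi * ℓ)) ‖f‖]
    refine mul_le_mul_of_nonneg_left ?_ (by positivity)
    have h0 : ∀ (w : Space n → ℂ) (y : EuclideanSpace ℝ (Fin n)), 0 ≤ fibreNorm σ w y :=
      fun w y => Real.sqrt_nonneg _
    refine (integral_mul_le_sqrt (h0 u) (h0 v) nu nv).trans ?_
    rw [nu', nv', Real.sqrt_sq (norm_nonneg _), Real.sqrt_sq (norm_nonneg _)]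

end SpectralDerivative
end ShearFlow
end

noncomputable section

namespace ShearFlow

/-! ### The derivative of the spectral family as an operator -/

section SpectralDensity

variable {n : ℕ}

theorem exists_spectralDensity {σ : ℝ} (hσ0 : 0 ≤ σ) {E : ℝ → L2 n →L[ℂ] L2 n} {lam C : ℝ}
    (hC : 0 ≤ C)
    (h : ∀ f g : X n σ, ∃ a : ℂ,
      HasDerivAt (fun μ : ℝ => inner ℂ (X.toL2 hσ0 g) (E μ (X.toL2 hσ0 f))) a lam ∧
        ‖a‖ ≤ C * ‖f‖ * ‖g‖) :
    ∃ A : X n σ →L[ℂ] X n (-σ),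
      (∀ f g : X n σ, HasDerivAt (fun μ : ℝ => inner ℂ (X.toL2 hσ0 g) (E μ (X.toL2 hσ0 f)))
        (pairing (A f) g) lam) ∧ ‖A‖ ≤ C := by
  -- The chosen values are sesquilinear in `(f, g)` because derivatives are unique.
  choose a ha hb using h
  let B : X n σ →ₗ[ℂ] X n σ →ₛₗ[starRingEnd ℂ] ℂ :=
    LinearMap.mk₂'ₛₗ (RingHom.id ℂ) (starRingEnd ℂ) a
      (fun f f' g => by
        refine (ha (f + f') g).unique ?_
        simpa only [toL2_add, map_add, inner_add_right] using! (ha f g).add (ha f' g))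
      (fun c f g => by
        refine (ha (c • f) g).unique ?_
        simpa only [toL2_smul, map_smul, inner_smul_right, RingHom.id_apply, smul_eq_mul]
          using! (ha f g).const_mul c)
      (fun f g g' => by
        refine (ha f (g + g')).unique ?_
        simpa only [toL2_add, inner_add_left] using! (ha f g).add (ha f g'))
      (fun c f g => by
        refine (ha f (c • g)).unique ?_
        simpa only [toL2_smul, inner_smul_left, smul_eq_mul] using! (ha f g).const_mul (conj c))
  let A : X n σ →L[ℂ] X n (-σ) :=
    ((dualityEquiv n σ).symm : (X n σ →L⋆[ℂ] ℂ) →L[ℂ] X n (-σ)) ∘L (B.mkContinuous₂ C hb)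
  have hA : ∀ f, dualityEquiv n σ (A f) = B.mkContinuous₂ C hb f :=
    fun f => (dualityEquiv n σ).apply_symm_apply _
  refine ⟨A, fun f g => ?_, ContinuousLinearMap.opNorm_le_bound _ hC fun f => ?_⟩
  · rw [← dualityEquiv_apply, hA]
    exact ha f g
  · rw [← (dualityEquiv n σ).norm_map, hA]
    exact ContinuousLinearMap.le_of_opNorm_le _ (LinearMap.mkContinuous₂_norm_le _ hC _) f

end SpectralDensity
end ShearFlow
end

/-! ### Main theorem -/

theorem mainTheorem9 (σ : ℝ) (hσ : 1 / 2 < σ) :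
    -- `𝓧^(-σ)` is the (anti-)dual space of `𝓧^σ` with respect to the `L²` inner product
    (∀ n : ℕ, ∃ D : ShearFlow.X n (-σ) ≃ₗᵢ[ℂ] (ShearFlow.X n σ →L⋆[ℂ] ℂ),
      ∀ (u : ShearFlow.X n (-σ)) (v : ShearFlow.X n σ), D u v = ShearFlow.pairing u v) ∧
    ∀ ℓ : ℝ, 0 < ℓ → ∃ C : ℝ, 0 < C ∧
      ∀ (n : ℕ) (ψ : EuclideanSpace ℝ (Fin n) → ℝ) (L : ℝ≥0), ShearFlow.IsRegular ψ ℓ L →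
        IsSelfAdjoint (ShearFlow.shearFlow ψ) ∧
        (∃! E : ℝ → ShearFlow.L2 n →L[ℂ] ShearFlow.L2 n,
          ShearFlow.IsSpectralFamily (ShearFlow.shearFlow ψ) E) ∧
        ∀ E : ℝ → ShearFlow.L2 n →L[ℂ] ShearFlow.L2 n,
          ShearFlow.IsSpectralFamily (ShearFlow.shearFlow ψ) E →
          ∀ lam : ℝ, ∃ A : ShearFlow.X n σ →L[ℂ] ShearFlow.X n (-σ),
            (∀ f g : ShearFlow.X n σ,
              HasDerivAt
                (fun μ : ℝ => inner ℂ (ShearFlow.X.toL2 (by linarith) g : ShearFlow.L2 n)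
                  (E μ (ShearFlow.X.toL2 (by linarith) f)))
                (ShearFlow.pairing (A f) g) lam) ∧
            (∀ f g : ShearFlow.X n σ,
              ‖deriv
                (fun μ : ℝ => inner ℂ (ShearFlow.X.toL2 (by linarith) g : ShearFlow.L2 n)
                  (E μ (ShearFlow.X.toL2 (by linarith) f))) lam‖
                ≤ C * (1 + ShearFlow.surfaceLipschitz ℓ L lam) * ‖f‖ * ‖g‖) ∧
            ‖A‖ ≤ C * (1 + ShearFlow.surfaceLipschitz ℓ L lam) := by
  refine ⟨fun n => ⟨ShearFlow.dualityEquiv n σ, ShearFlow.dualityEquiv_apply σ⟩, fun ℓ hℓ => ?_⟩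
  have hσ0 : 0 ≤ σ := by linarith
  have hc := ShearFlow.weightConst_nonneg σ
  -- The summand `1` makes the constant positive when only `weightConst σ ≥ 0` is known.
  refine ⟨ShearFlow.weightConst σ / (2 * Real.pi * ℓ) + 1, by positivity, fun n ψ L hreg => ?_⟩
  have hψ : Continuous ψ := hreg.lipschitz.continuous
  have hD := ShearFlow.diagonalizes_shearFlow hψ fun y => hℓ.trans (hreg.lower y)
  have hm := ShearFlow.measurable_shearSymbol hψ
  have hE := ShearFlow.isSpectralFamily_spectralProj hm hD
  refine ⟨hD.isSelfAdjoint hm, ⟨_, hE, fun E' hE' => hE'.unique hE⟩, fun E hEE lam => ?_⟩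
  -- By uniqueness, an arbitrary spectral family is the explicit one.
  obtain rfl := hEE.unique hE
  have hL : 0 ≤ ShearFlow.surfaceLipschitz ℓ L lam := by
    unfold ShearFlow.surfaceLipschitz
    positivity
  set C := (ShearFlow.weightConst σ / (2 * Real.pi * ℓ) + 1)
    * (1 + ShearFlow.surfaceLipschitz ℓ L lam) with hC
  have hC1 : ShearFlow.weightConst σ / (2 * Real.pi * ℓ) ≤ C := by
    have : 0 ≤ ShearFlow.weightConst σ / (2 * Real.pi * ℓ) := by positivity
    nlinarith
  have hbound : ∀ f g : ShearFlow.X n σ, ∃ a : ℂ,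
      HasDerivAt (fun μ : ℝ => inner ℂ (ShearFlow.X.toL2 hσ0 g)
        (ShearFlow.spectralProj (ShearFlow.fourierUnitary n) hm μ (ShearFlow.X.toL2 hσ0 f))) a lam ∧
        ‖a‖ ≤ C * ‖f‖ * ‖g‖ := by
    intro f g
    obtain ⟨a, h1, h2⟩ :=
      ShearFlow.exists_hasDerivAt_inner_spectralProj hσ hσ0 hψ hℓ hreg.lower lam f g
    exact ⟨a, h1, h2.trans (by gcongr)⟩
  obtain ⟨A, hA1, hA2⟩ := ShearFlow.exists_spectralDensity hσ0 (by positivity) hbound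
  refine ⟨A, hA1, fun f g => ?_, hA2⟩
  obtain ⟨a, h1, h2⟩ := hbound f g
  rw [h1.deriv]
  exact h2
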